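/- Let $\alpha\in(1,2)$, let $c=\dfrac{1-\alpha}{2\,\Gamma(2-\alpha)\cos(\pi\alpha/2)}$, and let $Z^{\alpha}$ be a symmetric $\alpha$-stable random variable with characteristic function $\mathbb{E}[e^{i\xi Z^{\alpha}}]=e^{-|\xi|^{\alpha}}$, $\xi\in\mathbb{R}$. Let $X$ be an integrable real random variable with $\mathbb{E}[X]=0$, and write its distribution function $F$ as $$F(x)=1-\frac{c+a_1(x)}{x^{\alpha}}\quad(x>0),\qquad F(x)=\frac{c+a_2(x)}{(-x)^{\alpha}}\quad(x<0).$$ Assume that $a_1$ is continuous and bounded on $(0,\infty)$, that $a_2$ is continuous and bounded on $(-\infty,0)$, and that the limits $\lim_{x\to+\infty}x\,a_1(x)$ and $\lim_{x\to-\infty}x\,a_2(x)$ exist and are finite (in particular $a_1(x)\to0$ as $x\to+\infty$ and $a_2(x)\to0$ as $x\to-\infty$, so that $X$ is in the normal domain of attraction of $Z^{\alpha}$). Then there is a constant $C>0$, depending only on $\alpha$, $a_1$ and $a_2$, such that for every integer $n\ge1$ and all independent copies $X_1,\dots,X_n$ of $X$, the random variable $W=n^{-1/\alpha}\sum_{i=1}^{n}X_i$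 satisfies $$\sup_{x\in\mathbb{R}}\bigl|\mathbb{P}(W\le x)-\mathbb{P}(Z^{\alpha}\le x)\bigr|\le\frac{C}{n^{\frac12\left(1-\frac{\alpha}{2}\right)}}.$$ -/

import Mathlib

open MeasureTheory ProbabilityTheory Filter Topology

namespace StableLaw

section Existence

open Set

/-- A pointwise limit of characteristic functions that is continuous at `0` is a characteristic
function. -/
theorem exists_measure_of_tendsto_charFun (μ : ℕ → ProbabilityMeasure ℝ) (f : ℝ → ℂ)
    (hf : ContinuousAt f 0)
    (h : ∀ t, Tendsto (fun n => charFun (μ n : Measure ℝ) t) atTop (𝓝 (f t))) :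
    ∃ ν : ProbabilityMeasure ℝ, ∀ t, charFun (ν : Measure ℝ) t = f t := by
  have ht : IsTightMeasureSet (Set.range fun n => (μ n : Measure ℝ)) :=
    isTightMeasureSet_of_tendsto_charFun hf h
  have hc : IsCompact (closure (Set.range μ)) := by
    apply isCompact_closure_of_isTightMeasureSet
    convert ht using 1
    ext; simp
  obtain ⟨ν, -, hν⟩ := hc.ultrafilter_le_nhds ((hyperfilter ℕ).map μ)
    (.trans (by simp) (Filter.monotone_principal subset_closure))
  refine ⟨ν, fun t => ?_⟩
  have hν' : Tendsto μ (hyperfilter ℕ) (𝓝 ν) := hν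
  rw [ProbabilityMeasure.tendsto_iff_forall_integral_rclike_tendsto ℂ] at hν'
  have h1 := hν' (BoundedContinuousFunction.innerProbChar t)
  simp_rw [← charFun_eq_integral_innerProbChar] at h1
  exact tendsto_nhds_unique h1 ((h t).mono_left (Nat.hyperfilter_le_atTop))

theorem integrableOn_one_sub_cos (α : ℝ) (hα : α ∈ Ioo (1 : ℝ) 2) (t : ℝ) :
    IntegrableOn (fun x : ℝ => (1 - Real.cos (t * x)) * x ^ (-(α + 1))) (Ioi 0) := by
  have hm : AEStronglyMeasurable (fun x : ℝ => (1 - Real.cos (t * x)) * x ^ (-(α + 1))) volume := by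
    apply Measurable.aestronglyMeasurable
    fun_prop
  rw [← Ioc_union_Ioi_eq_Ioi (zero_le_one (α := ℝ))]
  refine IntegrableOn.union ?_ ?_
  · have h1 : IntegrableOn (fun x : ℝ => t ^ 2 / 2 * x ^ (1 - α)) (Ioc 0 1) := by
      refine Integrable.const_mul ?_ _
      have := (intervalIntegral.intervalIntegrable_rpow' (a := 0) (b := 1)
        (show -1 < 1 - α by linarith [hα.2]))
      exact (intervalIntegrable_iff_integrableOn_Ioc_of_le zero_le_one).1 this
    refine Integrable.mono' h1 hm.restrict ?_
    filter_upwards [ae_restrict_mem measurableSet_Ioc] with x hx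
    have hx0 : 0 < x := hx.1
    have hc := Real.one_sub_sq_div_two_le_cos (x := t * x)
    rw [Real.norm_of_nonneg (mul_nonneg (by linarith [Real.cos_le_one (t * x)]) (by positivity))]
    calc (1 - Real.cos (t * x)) * x ^ (-(α + 1)) ≤ ((t * x) ^ 2 / 2) * x ^ (-(α + 1)) := by
          gcongr; linarith
      _ = t ^ 2 / 2 * (x ^ (2 : ℝ) * x ^ (-(α + 1))) := by
          rw [Real.rpow_two]; ring
      _ = t ^ 2 / 2 * x ^ (1 - α) := by
          rw [← Real.rpow_add hx0]; ring_nf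
  · have h1 : IntegrableOn (fun x : ℝ => 2 * x ^ (-(α + 1))) (Ioi 1) :=
      Integrable.const_mul (integrableOn_Ioi_rpow_of_lt (by linarith [hα.1]) one_pos) _
    refine Integrable.mono' h1 hm.restrict ?_
    filter_upwards [ae_restrict_mem measurableSet_Ioi] with x hx
    have hx0 : 0 < x := lt_trans one_pos hx
    rw [Real.norm_of_nonneg (mul_nonneg (by linarith [Real.cos_le_one (t * x)]) (by positivity))]
    gcongr
    linarith [Real.neg_one_le_cos (t * x)]

theorem integral_one_sub_cos (α : ℝ) (hα : α ∈ Ioo (1 : ℝ) 2) (t : ℝ) :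
    ∫ x in Ioi (0 : ℝ), (1 - Real.cos (t * x)) * x ^ (-(α + 1)) =
      |t| ^ α * ∫ x in Ioi (0 : ℝ), (1 - Real.cos x) * x ^ (-(α + 1)) := by
  rcases eq_or_ne t 0 with rfl | ht
  · simp [Real.zero_rpow (by linarith [hα.1] : α ≠ 0)]
  have h0 : 0 < |t| := abs_pos.2 ht
  have h := integral_comp_mul_left_Ioi
    (fun x : ℝ => (1 - Real.cos x) * x ^ (-(α + 1))) 0 h0
  rw [mul_zero, smul_eq_mul] at h
  have e : ∫ x in Ioi (0 : ℝ), (1 - Real.cos (t * x)) * x ^ (-(α + 1)) =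
      ∫ x in Ioi (0 : ℝ), |t| ^ (α + 1) *
        ((1 - Real.cos (|t| * x)) * (|t| * x) ^ (-(α + 1))) := by
    refine setIntegral_congr_fun measurableSet_Ioi fun x (hx : 0 < x) => ?_
    have hc : Real.cos (|t| * x) = Real.cos (t * x) := by
      rw [← Real.cos_abs (t * x), abs_mul, abs_of_pos hx]
    simp only [hc]
    rw [Real.mul_rpow h0.le hx.le, Real.rpow_neg h0.le]
    have := (Real.rpow_pos_of_pos h0 (α + 1)).ne'
    field_simp
  rw [e, integral_const_mul, h, ← mul_assoc, Real.rpow_add h0, Real.rpow_one]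
  field_simp

theorem integral_one_sub_cos_pos (α : ℝ) (hα : α ∈ Ioo (1 : ℝ) 2) :
    0 < ∫ x in Ioi (0 : ℝ), (1 - Real.cos x) * x ^ (-(α + 1)) := by
  have hi := integrableOn_one_sub_cos α hα 1
  simp only [one_mul] at hi
  rw [setIntegral_pos_iff_support_of_nonneg_ae _ hi]
  · have : Ioo (0 : ℝ) 1 ⊆
        Function.support (fun x : ℝ => (1 - Real.cos x) * x ^ (-(α + 1))) ∩ Ioi 0 := by
      intro x hx
      refine ⟨?_, hx.1⟩
      have h1 : Real.cos x < 1 := by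
        rw [← Real.cos_zero]
        exact Real.cos_lt_cos_of_nonneg_of_le_pi le_rfl (by linarith [hx.2, Real.pi_gt_three]) hx.1
      exact (mul_pos (by linarith) (Real.rpow_pos_of_pos hx.1 _)).ne'
    exact lt_of_lt_of_le (by simp) (measure_mono this)
  · filter_upwards [ae_restrict_mem measurableSet_Ioi] with x hx
    exact mul_nonneg (by linarith [Real.cos_le_one x]) (Real.rpow_nonneg (le_of_lt hx) _)

theorem re_charFun_pareto (α : ℝ) (hα : α ∈ Ioo (1 : ℝ) 2) (s : ℝ) (hs : 0 < s) (t : ℝ) :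
    (charFun (paretoMeasure s α) t).re = 1 - α * s ^ α *
      ∫ x in Ioi s, (1 - Real.cos (t * x)) * x ^ (-(α + 1)) := by
  have hα0 : 0 < α := by linarith [hα.1]
  have := isProbabilityMeasure_paretoMeasure hs hα0
  have hint : Integrable (fun x : ℝ => Complex.exp (t * x * Complex.I)) (paretoMeasure s α) := by
    refine Integrable.of_bound (C := 1) (by fun_prop) (.of_forall fun x => ?_)
    rw [← Complex.ofReal_mul, Complex.norm_exp_ofReal_mul_I]
  have hre : ∀ x : ℝ, (Complex.exp (t * x * Complex.I)).re = Real.cos (t * x) := fun x => by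
    rw [← Complex.ofReal_mul, Complex.exp_ofReal_mul_I_re]
  have hcos : Integrable (fun x : ℝ => Real.cos (t * x)) (paretoMeasure s α) := by
    have h := hint.re
    simp only [RCLike.re_to_complex, hre] at h
    exact h
  have h1 : (charFun (paretoMeasure s α) t).re = ∫ x, Real.cos (t * x) ∂paretoMeasure s α := by
    rw [charFun_apply_real]
    have := integral_re hint
    simp only [RCLike.re_to_complex, hre] at this
    exact this.symm
  have h2 : ∫ x, (1 - Real.cos (t * x)) ∂paretoMeasure s α = α * s ^ α *
      ∫ x in Ioi s, (1 - Real.cos (t * x)) * x ^ (-(α + 1)) := by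
    rw [paretoMeasure, integral_withDensity_eq_integral_toReal_smul
      (by unfold paretoPDF; fun_prop) (.of_forall fun x => by simp [paretoPDF]),
      ← integral_Ici_eq_integral_Ioi, ← integral_indicator measurableSet_Ici, ← integral_const_mul]
    congr 1; ext x
    rw [paretoPDF, ENNReal.toReal_ofReal (paretoPDFReal_nonneg hs.le hα0.le x), paretoPDFReal]
    by_cases hx : s ≤ x
    · simp [hx]; ring
    · simp [hx]
  rw [h1, ← h2, integral_sub (integrable_const _) hcos]
  simp

theorem exists_probabilityMeasure_charFun_eq_re (ρ : Measure ℝ) [IsProbabilityMeasure ρ] (n : ℕ) :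
    ∃ ν : ProbabilityMeasure ℝ, ∀ t, charFun (ν : Measure ℝ) t = (((charFun ρ t).re : ℝ) : ℂ) ^ n := by
  induction n with
  | zero => exact ⟨⟨Measure.dirac 0, inferInstance⟩, fun t => by simp [charFun_dirac]⟩
  | succ n ih =>
    obtain ⟨ν, hν⟩ := ih
    let σ : Measure ℝ := (2⁻¹ : ENNReal) • (ρ + ρ.map (fun x => (-1) * x))
    have : IsProbabilityMeasure (ρ.map (fun x => (-1) * x)) :=
      Measure.isProbabilityMeasure_map (by fun_prop)
    have hσ : IsProbabilityMeasure σ := by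
      constructor
      simp only [σ, Measure.smul_apply, Measure.add_apply, measure_univ, smul_eq_mul]
      rw [one_add_one_eq_two]
      exact ENNReal.inv_mul_cancel (by simp) (by simp)
    have hc : ∀ t, charFun σ t = (((charFun ρ t).re : ℝ) : ℂ) := fun t => by
      have hb : ∀ (τ : Measure ℝ) [IsProbabilityMeasure τ],
          Integrable (fun x : ℝ => Complex.exp (t * x * Complex.I)) τ := fun τ _ => by
        refine Integrable.of_bound (C := 1) (by fun_prop) (.of_forall fun x => ?_)
        rw [← Complex.ofReal_mul, Complex.norm_exp_ofReal_mul_I]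
      have e : charFun σ t = 2⁻¹ * (charFun ρ t + charFun (ρ.map (fun x => (-1) * x)) t) := by
        simp only [charFun_apply_real, σ]
        rw [integral_smul_measure, integral_add_measure (hb _) (hb _)]
        simp [mul_add]
      rw [e, charFun_map_mul, neg_one_mul, charFun_neg, Complex.add_conj]
      simp
    refine ⟨⟨(ν : Measure ℝ) ∗ σ, inferInstance⟩, fun t => ?_⟩
    rw [ProbabilityMeasure.coe_mk, charFun_conv, hν, hc, pow_succ]

/-- For `α ∈ (1, 2)` the function `ξ ↦ exp (-|ξ| ^ α)` is the characteristic function of a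
probability measure. -/
theorem exists_symmStable (α : ℝ) (hα : α ∈ Ioo (1 : ℝ) 2) :
    ∃ ν : ProbabilityMeasure ℝ, ∀ ξ : ℝ,
      charFun (ν : Measure ℝ) ξ = ((Real.exp (-|ξ| ^ α) : ℝ) : ℂ) := by
  have hα0 : 0 < α := by linarith [hα.1]
  set K := ∫ x in Ioi (0 : ℝ), (1 - Real.cos x) * x ^ (-(α + 1)) with hK
  have hKpos : 0 < K := integral_one_sub_cos_pos α hα
  let s : ℕ → ℝ := fun n => (1 / (α * K * (n + 1))) ^ (1 / α)
  have hs : ∀ n, 0 < s n := fun n => by positivity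
  have hs0 : Tendsto s atTop (𝓝 0) := by
    have h : Tendsto (fun n : ℕ => 1 / (α * K) * (1 / ((n : ℝ) + 1))) atTop (𝓝 0) := by
      simpa using tendsto_one_div_add_atTop_nhds_zero_nat.const_mul (1 / (α * K))
    have h2 := h.rpow_const (p := 1 / α) (Or.inr (by positivity))
    rw [Real.zero_rpow (by positivity)] at h2
    refine h2.congr fun n => ?_
    simp only [s]
    congr 1
    field_simp
  have hsα : ∀ n, α * s n ^ α = 1 / (K * (n + 1)) := fun n => by
    simp only [s]
    rw [← Real.rpow_mul (by positivity), one_div_mul_cancel hα0.ne', Real.rpow_one]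
    field_simp
  have hp : ∀ n, IsProbabilityMeasure (paretoMeasure (s n) α) := fun n =>
    isProbabilityMeasure_paretoMeasure (hs n) hα0
  choose μ hμ using fun n : ℕ => exists_probabilityMeasure_charFun_eq_re (paretoMeasure (s n) α) n
  refine exists_measure_of_tendsto_charFun μ _ ?_ fun t => ?_
  · have : Continuous fun ξ : ℝ => ((Real.exp (-|ξ| ^ α) : ℝ) : ℂ) :=
      Complex.continuous_ofReal.comp (Real.continuous_exp.comp
        ((continuous_abs.rpow_const fun _ => Or.inr hα0.le).neg))
    exact this.continuousAt
  · simp_rw [hμ, ← Complex.ofReal_pow]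
    refine (Complex.continuous_ofReal.tendsto _).comp ?_
    have hc : Tendsto (fun n => ∫ x in Ioi (s n), (1 - Real.cos (t * x)) * x ^ (-(α + 1)))
        atTop (𝓝 (|t| ^ α * K)) := by
      rw [hK, ← integral_one_sub_cos α hα t]
      have h := (aecover_Ioi_of_Ioi (μ := (volume : Measure ℝ))
        hs0).integral_tendsto_of_countably_generated (integrableOn_one_sub_cos α hα t)
      refine h.congr fun n => ?_
      rw [Measure.restrict_restrict measurableSet_Ioi,
        inter_eq_left.2 (Ioi_subset_Ioi (hs n).le)]
    have hn : Tendsto (fun n : ℕ => (n : ℝ) / (n + 1)) atTop (𝓝 1) :=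
      tendsto_natCast_div_add_atTop 1
    have := Real.tendsto_one_add_pow_exp_of_tendsto (t := -|t| ^ α)
      (g := fun n => (charFun (paretoMeasure (s n) α) t).re - 1) (by
        have h2 := ((hn.mul hc).const_mul (-1 / K))
        rw [show -1 / K * (1 * (|t| ^ α * K)) = -|t| ^ α by field_simp] at h2
        refine h2.congr fun n => ?_
        rw [re_charFun_pareto α hα _ (hs n), hsα]
        have : (n : ℝ) + 1 ≠ 0 := by positivity
        field_simp
        ring)
    simpa using this

end Existence

/-- The law of the symmetric `α`-stable random variable `Z^α`, `1 < α < 2`: the probability measure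
on `ℝ` with characteristic function `ξ ↦ exp (-|ξ| ^ α)`. -/
noncomputable def symmStable (α : ℝ) (hα : α ∈ Set.Ioo (1 : ℝ) 2) : ProbabilityMeasure ℝ :=
  (exists_symmStable α hα).choose

theorem charFun_symmStable (α : ℝ) (hα : α ∈ Set.Ioo (1 : ℝ) 2) (ξ : ℝ) :
    charFun (symmStable α hα : Measure ℝ) ξ = ((Real.exp (-|ξ| ^ α) : ℝ) : ℂ) :=
  (exists_symmStable α hα).choose_spec ξ

/-- The characteristic function determines `symmStable`, so no choice is involved. -/
theorem eq_symmStable (α : ℝ) (hα : α ∈ Set.Ioo (1 : ℝ) 2) (ν : Measure ℝ) [IsFiniteMeasure ν]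
    (h : ∀ ξ : ℝ, charFun ν ξ = ((Real.exp (-|ξ| ^ α) : ℝ) : ℂ)) :
    ν = (symmStable α hα : Measure ℝ) :=
  Measure.ext_of_charFun (funext fun ξ => by rw [h, charFun_symmStable])

/-- The tail constant `c = (1 - α) / (2 Γ(2 - α) cos (π α / 2))` of `Z^α`. -/
noncomputable def tailConst (α : ℝ) : ℝ :=
  (1 - α) / (2 * Real.Gamma (2 - α) * Real.cos (Real.pi * α / 2))

/-- `a₁` and `a₂` are the tail remainders of the law `μ`: with `F` the distribution function of `μ`,
`F x = 1 - (c + a₁ x) / x ^ α` for `x > 0` and `F x = (c + a₂ x) / (-x) ^ α` for `x < 0`. -/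
structure HasTailRemainders (α : ℝ) (a₁ a₂ : ℝ → ℝ) (μ : Measure ℝ) : Prop where
  right : ∀ x : ℝ, 0 < x → μ.real (Set.Iic x) = 1 - (tailConst α + a₁ x) / x ^ α
  left : ∀ x : ℝ, x < 0 → μ.real (Set.Iic x) = (tailConst α + a₂ x) / (-x) ^ α

/-- The standing assumptions on the tail remainders: `a₁` is continuous and bounded on `(0, ∞)`,
`a₂` is continuous and bounded on `(-∞, 0)`, and `x * a₁ x` (as `x → +∞`) and `x * a₂ x`
(as `x → -∞`) have finite limits. -/
structure TailAssumptions (a₁ a₂ : ℝ → ℝ) : Prop where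
  continuousOn_right : ContinuousOn a₁ (Set.Ioi 0)
  continuousOn_left : ContinuousOn a₂ (Set.Iio 0)
  bounded_right : ∃ M : ℝ, ∀ x : ℝ, 0 < x → |a₁ x| ≤ M
  bounded_left : ∃ M : ℝ, ∀ x : ℝ, x < 0 → |a₂ x| ≤ M
  limit_right : ∃ l : ℝ, Tendsto (fun x => x * a₁ x) atTop (𝓝 l)
  limit_left : ∃ l : ℝ, Tendsto (fun x => x * a₂ x) atBot (𝓝 l)

end StableLaw

/-! The argument is Fourier-analytic. Integrating the tails by parts gives `charFun μ t = 1 - |t| ^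
α + O(t ^ 2)` (`norm_charFun_sub_le`): the constant `c` is exactly the one for which the pure power
tails contribute `-|t| ^ α` (`two_mul_tailConst_mul_integral`), and the remainders `a₁`, `a₂`
contribute at most `t ^ 2` times a finite integral, because `x * a₁ x` and `x * a₂ x` stay bounded
at infinity. The `n`-th power of this expansion at `n ^ (-1/α) * t` differs from `exp (-|t| ^ α)` by
`O(n ^ (1 - 2/α) * t ^ 2 * exp (-|t| ^ α / 2))` for `|t| ≤ δ * n ^ (1/α)` (`norm_pow_sub_exp_le`).

To pass to distribution functions, the indicator of `(-∞, p]` is replaced by a ramp of width `ε`, a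
combination of `|w - p|` and `|w - (p + ε)|`. Since `|w|` is a multiple of `∫ (1 - cos (t * w)) / t
^ 2 dt`, ramp expectations are absolutely convergent integrals of characteristic functions, so no
inversion formula is needed. Frequencies beyond `T = δ * n ^ (1/α)` cost `O(1 / (ε * T))`. Replacing
the indicator by a ramp costs `O(ε)`, because the stable law gives short intervals mass proportional
to their length (`exists_symmStable_Ioc_le`).

With `ε` equal to the target rate `n ^ (-β)`, `β = (1 - α / 2) / 2`, the other two errors, of orders
`n ^ (1 - 2/α)` and `n ^ (β - 1/α)`, are no larger. -/

namespace StableLaw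

open Set

/-! ### The sine integral and the tail constant. -/

theorem integrableOn_min_mul_rpow {α : ℝ} (hα : α ∈ Ioo (1 : ℝ) 2) :
    IntegrableOn (fun x : ℝ => min 1 x * x ^ (-α)) (Ioi 0) := by
  have hm : Measurable (fun x : ℝ => min 1 x * x ^ (-α)) := by fun_prop
  rw [← Ioc_union_Ioi_eq_Ioi (zero_le_one (α := ℝ))]
  refine IntegrableOn.union ?_ ?_
  · have h1 : IntegrableOn (fun x : ℝ => x ^ (1 - α)) (Ioc 0 1) := by
      have := (intervalIntegral.intervalIntegrable_rpow' (a := 0) (b := 1)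
        (show -1 < 1 - α by linarith [hα.2]))
      exact (intervalIntegrable_iff_integrableOn_Ioc_of_le zero_le_one).1 this
    refine h1.congr_fun (fun x hx => ?_) measurableSet_Ioc
    simp only [min_eq_right hx.2, sub_eq_add_neg]
    rw [Real.rpow_add hx.1, Real.rpow_one]
  · refine (integrableOn_Ioi_rpow_of_lt (by linarith [hα.1] : -α < -1) one_pos).congr_fun
      (fun x hx => ?_) measurableSet_Ioi
    simp [min_eq_left (le_of_lt (show (1 : ℝ) < x from hx))]

/-- The bound separates `t` from `x`, which gives a product majorant for Fubini. -/
theorem abs_sin_mul_le {t x : ℝ} (ht : 0 ≤ t) (hx : 0 ≤ x) :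
    |Real.sin (t * x)| ≤ (1 + t) * min 1 x := by
  rcases le_total 1 x with h | h
  · rw [min_eq_left h]
    linarith [Real.abs_sin_le_one (t * x)]
  · rw [min_eq_right h]
    have h2 : |Real.sin (t * x)| ≤ |t * x| := Real.abs_sin_le_abs
    rw [abs_of_nonneg (mul_nonneg ht hx)] at h2
    nlinarith

theorem integrableOn_sin_mul_rpow {α : ℝ} (hα : α ∈ Ioo (1 : ℝ) 2) {t : ℝ} (ht : 0 ≤ t) :
    IntegrableOn (fun x : ℝ => Real.sin (t * x) * x ^ (-α)) (Ioi 0) := by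
  refine Integrable.mono' ((integrableOn_min_mul_rpow hα).const_mul (1 + t))
    (Measurable.aestronglyMeasurable (by fun_prop)) ?_
  filter_upwards [ae_restrict_mem measurableSet_Ioi] with x (hx : 0 < x)
  rw [norm_mul, Real.norm_eq_abs, Real.norm_of_nonneg (by positivity), ← mul_assoc]
  gcongr
  exact abs_sin_mul_le ht hx.le

theorem integral_sin_mul_rpow_scale {α : ℝ} {t : ℝ} (ht : 0 < t) :
    ∫ x in Ioi (0 : ℝ), Real.sin (t * x) * x ^ (-α) =
      t ^ (α - 1) * ∫ x in Ioi (0 : ℝ), Real.sin x * x ^ (-α) := by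
  have h := integral_comp_mul_left_Ioi (fun x : ℝ => Real.sin x * x ^ (-α)) 0 ht
  rw [mul_zero, smul_eq_mul] at h
  have e : ∫ x in Ioi (0 : ℝ), Real.sin (t * x) * x ^ (-α) =
      ∫ x in Ioi (0 : ℝ), t ^ α * (Real.sin (t * x) * (t * x) ^ (-α)) := by
    refine setIntegral_congr_fun measurableSet_Ioi fun x (hx : 0 < x) => ?_
    rw [Real.mul_rpow ht.le hx.le, Real.rpow_neg ht.le]
    have := (Real.rpow_pos_of_pos ht α).ne'
    field_simp
  rw [e, integral_const_mul, h, ← mul_assoc, Real.rpow_sub ht, Real.rpow_one]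
  rfl

theorem integral_exp_neg_mul_sin (x : ℝ) :
    ∫ t in Ioi (0 : ℝ), Real.exp (-t) * Real.sin (t * x) = x / (1 + x ^ 2) := by
  have hre : (-1 + x * Complex.I : ℂ).re < 0 := by simp
  have h := integral_exp_mul_complex_Ioi hre 0
  have hi := integrableOn_exp_mul_complex_Ioi hre 0
  have h2 := integral_im hi
  have e : ∀ t : ℝ, RCLike.im (Complex.exp ((-1 + x * Complex.I) * t)) =
      Real.exp (-t) * Real.sin (t * x) := fun t => by
    simp [Complex.exp_im, mul_comm]
  simp_rw [e] at h2
  rw [h2, h]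
  simp [Complex.div_im, Complex.normSq_apply]
  ring

/-- Writing `1 / (1 + x ^ 2)` as `∫ exp (-(1 + x ^ 2) * u) du` and integrating in `x` first leaves a
Gaussian moment, then a Gamma integral in `u`. -/
theorem integral_rpow_div_one_add_sq {α : ℝ} (hα : α ∈ Ioo (1 : ℝ) 2) :
    ∫ x in Ioi (0 : ℝ), x ^ (1 - α) / (1 + x ^ 2) =
      Real.Gamma (1 - α / 2) * Real.Gamma (α / 2) / 2 := by
  obtain ⟨h1, h2⟩ := hα
  let f : ℝ → ℝ → ℝ := fun x u => x ^ (1 - α) * Real.exp (-u) * Real.exp (-u * x ^ (2 : ℝ))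
  have hx : ∀ u ∈ Ioi (0 : ℝ), ∫ x in Ioi (0 : ℝ), f x u =
      Real.Gamma (1 - α / 2) / 2 * (Real.exp (-u) * u ^ (α / 2 - 1)) := fun u hu => by
    have := integral_rpow_mul_exp_neg_mul_rpow (p := 2) (q := 1 - α) (b := u) two_pos
      (by linarith) hu
    calc ∫ x in Ioi (0 : ℝ), f x u = ∫ x in Ioi (0 : ℝ),
          Real.exp (-u) * (x ^ (1 - α) * Real.exp (-u * x ^ (2 : ℝ))) := by
            congr 1; ext x; simp only [f]; ring
      _ = _ := by
        rw [integral_const_mul, this]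
        rw [show -(1 - α + 1) / 2 = α / 2 - 1 by ring, show (1 - α + 1) / 2 = 1 - α / 2 by ring]
        ring
  have hu : ∀ x ∈ Ioi (0 : ℝ), ∫ u in Ioi (0 : ℝ), f x u = x ^ (1 - α) / (1 + x ^ 2) :=
    fun x hx => by
      have := integral_exp_mul_Ioi (a := -(1 + x ^ 2)) (by nlinarith [sq_nonneg x]) 0
      calc ∫ u in Ioi (0 : ℝ), f x u = ∫ u in Ioi (0 : ℝ),
            x ^ (1 - α) * Real.exp (-(1 + x ^ 2) * u) := by
              congr 1; ext u; simp only [f]; rw [mul_assoc, ← Real.exp_add, Real.rpow_two]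
              ring_nf
        _ = _ := by
          rw [integral_const_mul, this]
          rw [mul_zero, Real.exp_zero, neg_div_neg_eq, mul_one_div]
  have hnn : ∀ u, ∀ x ∈ Ioi (0 : ℝ), 0 ≤ f x u := fun u x hx => by
    have : 0 < x := hx
    positivity
  have hΓ : IntegrableOn (fun u : ℝ => Real.exp (-u) * u ^ (α / 2 - 1)) (Ioi 0) :=
    Real.GammaIntegral_convergent (by linarith)
  have hint : Integrable (Function.uncurry f)
      ((volume.restrict (Ioi 0)).prod (volume.restrict (Ioi 0))) := by
    rw [integrable_prod_iff' (Measurable.aestronglyMeasurable (by fun_prop))]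
    constructor
    · filter_upwards [ae_restrict_mem measurableSet_Ioi] with u (hu : 0 < u)
      have := (integrableOn_rpow_mul_exp_neg_mul_rpow (p := 2) (s := 1 - α) (b := u)
        (by linarith) two_pos hu).const_mul (Real.exp (-u))
      refine this.congr (.of_forall fun x => ?_)
      simp only [f, Function.uncurry]; ring
    · refine (hΓ.const_mul (Real.Gamma (1 - α / 2) / 2)).congr ?_
      filter_upwards [ae_restrict_mem measurableSet_Ioi] with u hu
      rw [← hx u hu]
      refine setIntegral_congr_fun measurableSet_Ioi fun x hx => ?_
      exact (Real.norm_of_nonneg (hnn u x hx)).symm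
  have hswap := integral_integral_swap hint
  rw [setIntegral_congr_fun measurableSet_Ioi hu, setIntegral_congr_fun measurableSet_Ioi hx,
    integral_const_mul, ← Real.Gamma_eq_integral (by linarith)] at hswap
  rw [hswap]; ring

/-- The double integral of `exp (-t) * sin (t * x) * x ^ (-α)` is computed in both orders. Scaling
in `x` produces `t ^ (α - 1)`, hence the factor `Γ(α)`; integrating in `t` first produces `x / (1 +
x ^ 2)`. The weight `exp (-t)` makes the integrand jointly integrable. -/
theorem integral_sin_mul_rpow {α : ℝ} (hα : α ∈ Ioo (1 : ℝ) 2) :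
    Real.Gamma α * ∫ x in Ioi (0 : ℝ), Real.sin x * x ^ (-α) =
      Real.Gamma (1 - α / 2) * Real.Gamma (α / 2) / 2 := by
  have hα1 := hα.1
  let f : ℝ → ℝ → ℝ := fun t x => Real.exp (-t) * Real.sin (t * x) * x ^ (-α)
  have hx : ∀ t ∈ Ioi (0 : ℝ), ∫ x in Ioi (0 : ℝ), f t x =
      Real.exp (-t) * t ^ (α - 1) * ∫ x in Ioi (0 : ℝ), Real.sin x * x ^ (-α) := fun t ht => by
    simp only [f, mul_assoc]
    rw [integral_const_mul, integral_sin_mul_rpow_scale ht]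
  have ht : ∀ x ∈ Ioi (0 : ℝ), ∫ t in Ioi (0 : ℝ), f t x = x ^ (1 - α) / (1 + x ^ 2) :=
    fun x hx => by
      simp only [f]
      rw [integral_mul_const, integral_exp_neg_mul_sin, sub_eq_add_neg, Real.rpow_add hx,
        Real.rpow_one]
      ring
  have hexp : IntegrableOn (fun t : ℝ => Real.exp (-t) * (1 + t)) (Ioi 0) := by
    have h1 := Real.GammaIntegral_convergent (s := 1) one_pos
    have h2 := Real.GammaIntegral_convergent (s := 2) two_pos
    refine (h1.add h2).congr_fun (fun t _ => ?_) measurableSet_Ioi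
    norm_num
    ring
  have hint : Integrable (Function.uncurry f)
      ((volume.restrict (Ioi 0)).prod (volume.restrict (Ioi 0))) := by
    refine Integrable.mono' (Integrable.mul_prod hexp (integrableOn_min_mul_rpow hα))
      (Measurable.aestronglyMeasurable (by fun_prop)) ?_
    rw [Measure.prod_restrict]
    filter_upwards [ae_restrict_mem (measurableSet_Ioi.prod measurableSet_Ioi)] with p hp
    have hp1 : 0 < p.1 := hp.1
    have hp2 : 0 < p.2 := hp.2
    simp only [Function.uncurry, f]
    rw [norm_mul, norm_mul, Real.norm_of_nonneg (Real.exp_pos _).le,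
      Real.norm_of_nonneg (Real.rpow_nonneg hp2.le _), Real.norm_eq_abs, mul_assoc, mul_assoc,
      ← mul_assoc (1 + p.1)]
    gcongr
    exact abs_sin_mul_le hp1.le hp2.le
  have hswap := integral_integral_swap hint
  rw [setIntegral_congr_fun measurableSet_Ioi hx, setIntegral_congr_fun measurableSet_Ioi ht,
    integral_mul_const, ← Real.Gamma_eq_integral (by linarith),
    integral_rpow_div_one_add_sq hα] at hswap
  exact hswap

/-- This is the normalization of `c` to the exponent `exp (-|ξ| ^ α)`. It follows from the
reflection formula at `α / 2` and at `α`, together with the double-angle formula for the sine. -/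
theorem two_mul_tailConst_mul_integral {α : ℝ} (hα : α ∈ Ioo (1 : ℝ) 2) :
    2 * tailConst α * ∫ x in Ioi (0 : ℝ), Real.sin x * x ^ (-α) = 1 := by
  have h := integral_sin_mul_rpow hα
  obtain ⟨h1, h2⟩ := hα
  have hr1 := Real.Gamma_mul_Gamma_one_sub (α / 2)
  have hr2 := Real.Gamma_mul_Gamma_one_sub α
  have hΓ : Real.Gamma (2 - α) = (1 - α) * Real.Gamma (1 - α) := by
    rw [← Real.Gamma_add_one (by linarith)]; ring_nf
  have hs : Real.sin (Real.pi * α) =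
      2 * Real.sin (Real.pi * α / 2) * Real.cos (Real.pi * α / 2) := by
    rw [← Real.sin_two_mul]; ring_nf
  have hΓ0 : 0 < Real.Gamma α := Real.Gamma_pos_of_pos (by linarith)
  have hΓ2 : 0 < Real.Gamma (2 - α) := Real.Gamma_pos_of_pos (by linarith)
  have hpi := Real.pi_pos
  have hs1 : 0 < Real.sin (Real.pi * α / 2) :=
    Real.sin_pos_of_pos_of_lt_pi (by positivity) (by nlinarith)
  have hc : Real.cos (Real.pi * α / 2) < 0 :=
    Real.cos_neg_of_pi_div_two_lt_of_lt (by nlinarith) (by nlinarith)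
  rw [hs] at hr2
  rw [show Real.pi * (α / 2) = Real.pi * α / 2 by ring] at hr1
  set S := ∫ x in Ioi (0 : ℝ), Real.sin x * x ^ (-α)
  rw [mul_comm (Real.Gamma (1 - α / 2)), hr1] at h
  unfold tailConst
  have hc' := hc.ne
  have hs' := hs1.ne'
  field_simp at h hr2 ⊢
  rw [← mul_left_inj' hΓ0.ne']
  rw [hΓ]
  have h1α : 1 - α ≠ 0 := by linarith
  rw [← mul_left_inj' hs']
  linear_combination (1 - α) / 2 * h - (1 - α) / 2 * hr2

/-! ### The absolute value as a cosine integral. -/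

theorem one_sub_cos_div_sq_le (t : ℝ) : (1 - Real.cos t) / t ^ 2 ≤ 3 * (1 + t ^ 2)⁻¹ := by
  rcases eq_or_ne t 0 with rfl | ht
  · simp
  have h1 := Real.one_sub_sq_div_two_le_cos (x := t)
  have h2 := Real.neg_one_le_cos t
  have h0 : 0 < t ^ 2 := by positivity
  rw [← div_eq_mul_inv, div_le_div_iff₀ h0 (by positivity)]
  nlinarith

theorem integrable_one_sub_cos_div_sq : Integrable fun t : ℝ => (1 - Real.cos t) / t ^ 2 := by
  refine Integrable.mono' (integrable_inv_one_add_sq.const_mul 3)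
    (Measurable.aestronglyMeasurable (by fun_prop)) (.of_forall fun t => ?_)
  rw [Real.norm_of_nonneg (div_nonneg (by linarith [Real.cos_le_one t]) (sq_nonneg t))]
  exact one_sub_cos_div_sq_le t

/-- The constant in `∫ (1 - cos (t * x)) / t ^ 2 dt = cosConst * |x|`. -/
noncomputable def cosConst : ℝ := ∫ t : ℝ, (1 - Real.cos t) / t ^ 2

theorem cosConst_pos : 0 < cosConst := by
  unfold cosConst
  rw [integral_pos_iff_support_of_nonneg
    (fun t => div_nonneg (by linarith [Real.cos_le_one t]) (sq_nonneg t))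
    integrable_one_sub_cos_div_sq]
  have : Ioo (0 : ℝ) 1 ⊆ Function.support fun t : ℝ => (1 - Real.cos t) / t ^ 2 := by
    intro x hx
    have h1 : Real.cos x < 1 := by
      rw [← Real.cos_zero]
      exact Real.cos_lt_cos_of_nonneg_of_le_pi le_rfl (by linarith [hx.2, Real.pi_gt_three]) hx.1
    exact (div_pos (by linarith) (pow_pos hx.1 2)).ne'
  exact lt_of_lt_of_le (by simp) (measure_mono this)

theorem one_sub_cos_mul_div_sq (x t : ℝ) :
    (1 - Real.cos (t * x)) / t ^ 2 = x ^ 2 * ((1 - Real.cos (x * t)) / (x * t) ^ 2) := by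
  rcases eq_or_ne x 0 with rfl | hx
  · simp
  rcases eq_or_ne t 0 with rfl | ht
  · simp
  rw [mul_comm t x]
  field_simp

theorem integrable_one_sub_cos_mul_div_sq (x : ℝ) :
    Integrable fun t : ℝ => (1 - Real.cos (t * x)) / t ^ 2 := by
  simp_rw [one_sub_cos_mul_div_sq]
  rcases eq_or_ne x 0 with rfl | hx
  · simp
  exact (integrable_one_sub_cos_div_sq.comp_mul_left' hx).const_mul _

theorem integral_one_sub_cos_mul_div_sq (x : ℝ) :
    ∫ t : ℝ, (1 - Real.cos (t * x)) / t ^ 2 = cosConst * |x| := by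
  simp_rw [one_sub_cos_mul_div_sq]
  rw [integral_const_mul, Measure.integral_comp_mul_left (fun t => (1 - Real.cos t) / t ^ 2) x,
    smul_eq_mul, ← cosConst]
  rcases eq_or_ne x 0 with rfl | hx
  · simp
  rw [abs_inv, ← sq_abs]
  have := abs_pos.2 hx
  field_simp

theorem one_sub_cos_mul_div_sq_nonneg (x t : ℝ) : 0 ≤ (1 - Real.cos (t * x)) / t ^ 2 :=
  div_nonneg (by linarith [Real.cos_le_one (t * x)]) (sq_nonneg t)

/-! ### Absolute moments, ramps and concentration through characteristic functions. -/

section Law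

variable (ν : Measure ℝ) [IsProbabilityMeasure ν]

theorem integrable_cos (p t : ℝ) : Integrable (fun w : ℝ => Real.cos (t * (w - p))) ν :=
  Integrable.of_bound (C := 1) (Measurable.aestronglyMeasurable (by fun_prop))
    (.of_forall fun w => Real.abs_cos_le_one _)

theorem integral_cos_eq (p t : ℝ) : ∫ w, Real.cos (t * (w - p)) ∂ν =
    (Complex.exp (-(t * p : ℝ) * Complex.I) * charFun ν t).re := by
  have hi : Integrable
      (fun w : ℝ => Complex.exp (-(t * p : ℝ) * Complex.I) * Complex.exp (t * w * Complex.I)) ν := by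
    refine Integrable.of_bound (C := 1) (Measurable.aestronglyMeasurable (by fun_prop))
      (.of_forall fun w => ?_)
    rw [norm_mul, ← Complex.ofReal_neg, ← Complex.ofReal_mul, Complex.norm_exp_ofReal_mul_I,
      Complex.norm_exp_ofReal_mul_I, one_mul]
  rw [charFun_apply_real, ← integral_const_mul]
  have h := integral_re hi
  simp only [RCLike.re_to_complex] at h
  rw [← h]
  congr 1; ext w
  rw [← Complex.exp_add, ← add_mul]
  rw [show (-((t * p : ℝ) : ℂ) + t * w) = ((t * (w - p) : ℝ) : ℂ) by push_cast; ring,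
    Complex.exp_ofReal_mul_I_re]

/-- The mean of `w ↦ (1 - cos (t * (w - p))) / t ^ 2` under `ν`, in terms of the characteristic
function of `ν`. -/
noncomputable def cosDefect (p t : ℝ) : ℝ :=
  (1 - (Complex.exp (-(t * p : ℝ) * Complex.I) * charFun ν t).re) / t ^ 2

theorem integral_one_sub_cos_law (p t : ℝ) : ∫ w, (1 - Real.cos (t * (w - p))) / t ^ 2 ∂ν =
    cosDefect ν p t := by
  unfold cosDefect
  rw [integral_div, integral_sub (integrable_const _) (integrable_cos ν p t), integral_cos_eq]
  simp

variable {ν}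

theorem integrable_prod_one_sub_cos (h : Integrable (fun w : ℝ => w) ν) (p : ℝ) :
    Integrable (fun q : ℝ × ℝ => (1 - Real.cos (q.2 * (q.1 - p))) / q.2 ^ 2)
      (ν.prod volume) := by
  rw [integrable_prod_iff (Measurable.aestronglyMeasurable (by fun_prop))]
  refine ⟨.of_forall fun w => integrable_one_sub_cos_mul_div_sq (w - p), ?_⟩
  refine ((h.sub (integrable_const p)).abs.const_mul cosConst).congr (.of_forall fun w => ?_)
  simp only [Real.norm_of_nonneg (one_sub_cos_mul_div_sq_nonneg _ _)]
  exact (integral_one_sub_cos_mul_div_sq _).symm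

theorem integrable_one_sub_charFun (h : Integrable (fun w : ℝ => w) ν) (p : ℝ) :
    Integrable (cosDefect ν p) := by
  have := (integrable_prod_one_sub_cos h p).integral_prod_right
  simpa only [integral_one_sub_cos_law] using this

theorem cosConst_mul_integral_abs (h : Integrable (fun w : ℝ => w) ν) (p : ℝ) :
    cosConst * ∫ w, |w - p| ∂ν = ∫ t : ℝ, cosDefect ν p t := by
  have := integral_integral_swap (f := fun w t : ℝ => (1 - Real.cos (t * (w - p))) / t ^ 2)
    (integrable_prod_one_sub_cos h p)
  simp only [integral_one_sub_cos_law, integral_one_sub_cos_mul_div_sq] at this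
  rw [← this, integral_const_mul]

/-- Tonelli: the integrand `(1 - cos (t * w)) / t ^ 2` is nonnegative, so integrability in the order
`w`, then `t`, gives integrability of its `t`-integral `cosConst * |w|`. -/
theorem integrable_id_of_charFun
    (h : Integrable fun t : ℝ => (1 - (charFun ν t).re) / t ^ 2) :
    Integrable (fun w : ℝ => w) ν := by
  have hp : Integrable (fun q : ℝ × ℝ => (1 - Real.cos (q.2 * q.1)) / q.2 ^ 2)
      (ν.prod volume) := by
    rw [integrable_prod_iff' (Measurable.aestronglyMeasurable (by fun_prop))]
    constructor
    · refine .of_forall fun t => ?_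
      have := ((integrable_const 1).sub (integrable_cos ν 0 t)).div_const (t ^ 2)
      simpa using this
    · refine h.congr (.of_forall fun t => ?_)
      simp only [Real.norm_of_nonneg (one_sub_cos_mul_div_sq_nonneg _ _)]
      have := integral_one_sub_cos_law ν 0 t
      simpa [cosDefect] using this.symm
  have h2 := hp.integral_prod_left
  simp only [integral_one_sub_cos_mul_div_sq] at h2
  have h3 : Integrable (fun w : ℝ => |w|) ν := by
    refine (h2.const_mul cosConst⁻¹).congr (.of_forall fun w => ?_)
    simp [cosConst_pos.ne']
  exact (integrable_norm_iff (f := fun w : ℝ => w) (Measurable.aestronglyMeasurable (by fun_prop))).1 h3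

/-- The difference of the expectations of `w ↦ |w - p| - |w - q|` under two laws, bounded through
the difference of the characteristic functions. -/
theorem abs_integral_ramp_sub_le {ρ : Measure ℝ} [IsProbabilityMeasure ρ]
    (h : Integrable (fun w : ℝ => w) ν) (h' : Integrable (fun w : ℝ => w) ρ)
    {p q : ℝ} {g : ℝ → ℝ} (hg : Integrable g)
    (hle : ∀ t : ℝ, t ≠ 0 →
      min 2 (|t| * |p - q|) * ‖charFun ρ t - charFun ν t‖ / t ^ 2 ≤ g t) :
    cosConst * |(∫ w, |w - p| ∂ν - ∫ w, |w - q| ∂ν) - (∫ w, |w - p| ∂ρ - ∫ w, |w - q| ∂ρ)| ≤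
      ∫ t, g t := by
  have habs : ∀ r : ℝ, cosConst * |r| = |cosConst * r| := fun r => by
    rw [abs_mul, abs_of_pos cosConst_pos]
  rw [habs]
  simp only [mul_sub, cosConst_mul_integral_abs h, cosConst_mul_integral_abs h']
  rw [← integral_sub' (integrable_one_sub_charFun h p) (integrable_one_sub_charFun h q),
    ← integral_sub' (integrable_one_sub_charFun h' p) (integrable_one_sub_charFun h' q),
    ← integral_sub' ((integrable_one_sub_charFun h p).sub (integrable_one_sub_charFun h q))
      ((integrable_one_sub_charFun h' p).sub (integrable_one_sub_charFun h' q)),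
    ← Real.norm_eq_abs]
  refine norm_integral_le_of_norm_le hg ?_
  filter_upwards [compl_mem_ae_iff.2 (measure_singleton (0 : ℝ))] with t ht
  refine le_trans (b := |((Complex.exp (-(t * p : ℝ) * Complex.I) -
    Complex.exp (-(t * q : ℝ) * Complex.I)) * (charFun ρ t - charFun ν t)).re| / t ^ 2)
    (le_of_eq ?_) (le_trans ?_ (hle t ht))
  · rw [Real.norm_eq_abs]
    have hd : ∀ r : ℝ, |r| / t ^ 2 = |r / t ^ 2| := fun r => by
      rw [abs_div, abs_of_nonneg (sq_nonneg t)]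
    rw [hd]
    congr 1
    simp only [Pi.sub_apply, cosDefect, sub_mul, mul_sub, Complex.sub_re]
    ring
  · gcongr
    refine (Complex.abs_re_le_norm _).trans ?_
    rw [norm_mul]
    gcongr
    -- The bound `2` serves the high frequencies, the Lipschitz bound `|t| * |p - q|` the low ones.
    refine le_min ?_ ?_
    · refine (norm_sub_le _ _).trans ?_
      rw [← Complex.ofReal_neg, ← Complex.ofReal_neg, Complex.norm_exp_ofReal_mul_I,
        Complex.norm_exp_ofReal_mul_I]
      norm_num
    · have e : Complex.exp (-(t * p : ℝ) * Complex.I) - Complex.exp (-(t * q : ℝ) * Complex.I) =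
          Complex.exp ((-(t * q) : ℝ) * Complex.I) *
            (Complex.exp (Complex.I * ((-(t * (p - q)) : ℝ) : ℂ)) - 1) := by
        rw [mul_sub, ← Complex.exp_add, mul_one]
        push_cast
        ring_nf
      rw [e, norm_mul, Complex.norm_exp_ofReal_mul_I, one_mul]
      refine Real.norm_exp_I_mul_ofReal_sub_one_le.trans (le_of_eq ?_)
      rw [norm_neg, Real.norm_eq_abs, abs_mul]

/-- Concentration bound: the law of a variable with integrable characteristic function gives an
interval of length `δ` mass at most a constant times `δ`. -/
theorem measureReal_Ioc_le_of_charFun (h : Integrable (fun w : ℝ => w) ν)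
    (hφ : Integrable fun t => ‖charFun ν t‖) (x : ℝ) {δ : ℝ} (hδ : 0 < δ) :
    ν.real (Ioc x (x + δ)) ≤ (∫ t, ‖charFun ν t‖) / cosConst * δ := by
  set y := x + δ / 2 with hy
  have hI : ∀ p, Integrable (fun w : ℝ => |w - p|) ν := fun p => (h.sub (integrable_const p)).abs
  -- The second difference of `|w - ·|` at the midpoint `y` is a nonnegative tent of height `2 * δ`,
  -- and it is at least `δ` on the interval.
  have h1 : δ * ν.real (Ioc x (x + δ)) ≤
      ∫ w, (|w - (y - δ)| + |w - (y + δ)| - 2 * |w - y|) ∂ν := by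
    rw [mul_comm, ← smul_eq_mul, ← integral_indicator_const _ measurableSet_Ioc]
    refine integral_mono ((integrable_const δ).indicator measurableSet_Ioc)
      (((hI _).add (hI _)).sub ((hI _).const_mul 2)) fun w => ?_
    by_cases hw : w ∈ Ioc x (x + δ)
    · rw [indicator_of_mem hw]
      have := le_abs_self (w - (y - δ))
      have := neg_abs_le (w - (y + δ))
      have : |w - y| ≤ δ / 2 := abs_le.2 ⟨by linarith [hw.1], by linarith [hw.2]⟩
      simp only
      linarith
    · rw [indicator_of_notMem hw]
      have := abs_add_le (w - (y - δ)) (w - (y + δ))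
      rw [show w - (y - δ) + (w - (y + δ)) = 2 * (w - y) by ring, abs_mul, abs_two] at this
      simp only
      linarith
  have h2 : cosConst * ∫ w, (|w - (y - δ)| + |w - (y + δ)| - 2 * |w - y|) ∂ν ≤
      ∫ t, δ ^ 2 * ‖charFun ν t‖ := by
    have e : ∫ w, (|w - (y - δ)| + |w - (y + δ)| - 2 * |w - y|) ∂ν =
        ∫ w, |w - (y - δ)| ∂ν + ∫ w, |w - (y + δ)| ∂ν - 2 * ∫ w, |w - y| ∂ν := by
      rw [← integral_add (hI _) (hI _), ← integral_const_mul]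
      exact integral_sub ((hI _).add (hI _)) ((hI _).const_mul 2)
    rw [e, mul_sub, mul_add, mul_left_comm, cosConst_mul_integral_abs h,
      cosConst_mul_integral_abs h, cosConst_mul_integral_abs h, ← integral_const_mul,
      ← integral_add' (integrable_one_sub_charFun h _) (integrable_one_sub_charFun h _),
      ← integral_sub' ((integrable_one_sub_charFun h _).add (integrable_one_sub_charFun h _))
        ((integrable_one_sub_charFun h _).const_mul 2)]
    refine integral_mono_ae (((integrable_one_sub_charFun h _).add
      (integrable_one_sub_charFun h _)).sub ((integrable_one_sub_charFun h _).const_mul 2))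
      (hφ.const_mul _) ?_
    filter_upwards [compl_mem_ae_iff.2 (measure_singleton (0 : ℝ))] with t ht
    have ht0 : 0 < t ^ 2 := by
      have : t ≠ 0 := ht
      positivity
    -- The second difference becomes multiplication by `(2 - 2 * cos (t * δ)) / t ^ 2`, which is at
    -- most `δ ^ 2`. Dividing by the `δ` of `h1` leaves one factor `δ`.
    have e : cosDefect ν (y - δ) t + cosDefect ν (y + δ) t - 2 * cosDefect ν y t =
        ((2 - 2 * Real.cos (t * δ)) / t ^ 2) *
          (Complex.exp (-(t * y : ℝ) * Complex.I) * charFun ν t).re := by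
      have e1 : Complex.exp (-(t * (y - δ) : ℝ) * Complex.I) +
          Complex.exp (-(t * (y + δ) : ℝ) * Complex.I) =
          ((2 * Real.cos (t * δ) : ℝ) : ℂ) * Complex.exp (-(t * y : ℝ) * Complex.I) := by
        rw [show ((2 * Real.cos (t * δ) : ℝ) : ℂ) = 2 * Complex.cos ((t * δ : ℝ) : ℂ) by
          push_cast; rfl, Complex.two_cos, add_mul, ← Complex.exp_add, ← Complex.exp_add]
        push_cast
        ring_nf
      have e2 := congrArg (fun z => (z * charFun ν t).re) e1
      simp only [add_mul, Complex.add_re, mul_assoc, Complex.re_ofReal_mul] at e2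
      simp only [cosDefect]
      linear_combination -e2 / t ^ 2
    simp only [Pi.sub_apply, Pi.add_apply]
    rw [e]
    have hz : (Complex.exp (-(t * y : ℝ) * Complex.I) * charFun ν t).re ≤ ‖charFun ν t‖ := by
      refine (Complex.re_le_norm _).trans (le_of_eq ?_)
      rw [norm_mul, ← Complex.ofReal_neg, Complex.norm_exp_ofReal_mul_I, one_mul]
    have hc1 := Real.cos_le_one (t * δ)
    have hc2 := Real.one_sub_sq_div_two_le_cos (x := t * δ)
    calc _ ≤ ((2 - 2 * Real.cos (t * δ)) / t ^ 2) * ‖charFun ν t‖ := by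
          have : 0 ≤ (2 - 2 * Real.cos (t * δ)) / t ^ 2 := div_nonneg (by linarith) ht0.le
          gcongr
      _ ≤ δ ^ 2 * ‖charFun ν t‖ := by
          gcongr
          rw [div_le_iff₀ ht0]
          nlinarith
  rw [integral_const_mul] at h2
  have h3 := (mul_le_mul_of_nonneg_left h1 cosConst_pos.le).trans h2
  rw [div_mul_eq_mul_div, le_div_iff₀ cosConst_pos]
  rw [← mul_le_mul_iff_right₀ hδ]
  linarith

end Law

/-! ### First moment and concentration of the stable law. -/

theorem integrable_comp_abs {f : ℝ → ℝ} (hf : IntegrableOn f (Ioi 0)) :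
    Integrable fun x => f |x| := by
  have h1 : IntegrableOn (fun x => f |x|) (Ioi 0) :=
    hf.congr_fun (fun x hx => by rw [abs_of_pos (show (0 : ℝ) < x from hx)]) measurableSet_Ioi
  have h2 : IntegrableOn (fun x => f |x|) (Iic 0) := by
    have := (integrableOn_Ici_iff_integrableOn_Ioi (by simp) |>.2 h1).comp_neg
    simpa using this
  rw [← integrableOn_univ, ← Iic_union_Ioi (a := (0 : ℝ))]
  exact h2.union h1

theorem integrable_abs_rpow_mul_exp {α s b : ℝ} (hα : 0 < α) (hs : -1 < s) (hb : 0 < b) :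
    Integrable fun t : ℝ => |t| ^ s * Real.exp (-b * |t| ^ α) :=
  integrable_comp_abs (integrableOn_rpow_mul_exp_neg_mul_rpow hs hα hb)

theorem integrable_one_sub_exp_div_sq {α : ℝ} (hα : α ∈ Ioo (1 : ℝ) 2) :
    Integrable fun t : ℝ => (1 - Real.exp (-|t| ^ α)) / t ^ 2 := by
  have key : IntegrableOn (fun x : ℝ => (1 - Real.exp (-x ^ α)) / x ^ 2) (Ioi 0) := by
    have hm : Measurable fun x : ℝ => (1 - Real.exp (-x ^ α)) / x ^ 2 := by fun_prop
    have hnn : ∀ x : ℝ, 0 < x → 0 ≤ (1 - Real.exp (-x ^ α)) / x ^ 2 := fun x hx => by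
      have : Real.exp (-x ^ α) ≤ 1 := Real.exp_le_one_iff.2 (by
        have := Real.rpow_nonneg hx.le α
        linarith)
      exact div_nonneg (by linarith) (sq_nonneg x)
    rw [← Ioc_union_Ioi_eq_Ioi (zero_le_one (α := ℝ))]
    refine IntegrableOn.union ?_ ?_
    · have h1 : IntegrableOn (fun x : ℝ => x ^ (α - 2)) (Ioc 0 1) :=
        (intervalIntegrable_iff_integrableOn_Ioc_of_le zero_le_one).1
          (intervalIntegral.intervalIntegrable_rpow' (by linarith [hα.1]))
      refine Integrable.mono' h1 hm.aestronglyMeasurable ?_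
      filter_upwards [ae_restrict_mem measurableSet_Ioc] with x hx
      rw [Real.norm_of_nonneg (hnn x hx.1), Real.rpow_sub hx.1, Real.rpow_two]
      gcongr
      linarith [Real.add_one_le_exp (-x ^ α)]
    · have h1 : IntegrableOn (fun x : ℝ => x ^ (-2 : ℝ)) (Ioi 1) :=
        integrableOn_Ioi_rpow_of_lt (by norm_num) one_pos
      refine Integrable.mono' h1 hm.aestronglyMeasurable ?_
      filter_upwards [ae_restrict_mem measurableSet_Ioi] with x hx
      have hx0 : 0 < x := lt_trans one_pos hx
      rw [Real.norm_of_nonneg (hnn x hx0), Real.rpow_neg hx0.le, Real.rpow_two, ← one_div]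
      gcongr
      linarith [Real.exp_pos (-x ^ α)]
  simpa using integrable_comp_abs key

theorem integrable_id_symmStable {α : ℝ} (hα : α ∈ Ioo (1 : ℝ) 2) :
    Integrable (fun w : ℝ => w) (symmStable α hα : Measure ℝ) := by
  apply integrable_id_of_charFun
  simp only [charFun_symmStable, Complex.ofReal_re]
  exact integrable_one_sub_exp_div_sq hα

theorem exists_symmStable_Ioc_le {α : ℝ} (hα : α ∈ Ioo (1 : ℝ) 2) :
    ∃ m : ℝ, 0 ≤ m ∧ ∀ x δ : ℝ, 0 < δ →
      (symmStable α hα : Measure ℝ).real (Ioc x (x + δ)) ≤ m * δ := by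
  refine ⟨(∫ t, ‖charFun (symmStable α hα : Measure ℝ) t‖) / cosConst,
    div_nonneg (integral_nonneg fun t => norm_nonneg _) cosConst_pos.le, fun x δ hδ => ?_⟩
  refine measureReal_Ioc_le_of_charFun (integrable_id_symmStable hα) ?_ x hδ
  have := integrable_abs_rpow_mul_exp (α := α) (s := 0) (b := 1) (by linarith [hα.1])
    (by norm_num) one_pos
  refine this.congr (.of_forall fun t => ?_)
  simp only [charFun_symmStable, Complex.norm_real, Real.norm_of_nonneg (Real.exp_pos _).le]
  simp

/-! ### The characteristic function as an integral of the tails. -/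

section TailFormula

variable {μ : Measure ℝ}

/-- Integrating in `x` over `(0, w)` leaves at most `B * |w|`, so a finite first moment suffices for
Fubini. -/
theorem integrable_prod_indicator_tail (h : Integrable (fun w : ℝ => w) μ) {g : ℝ → ℂ}
    (hg : Measurable g) {B : ℝ} (hB : ∀ x, ‖g x‖ ≤ B) :
    Integrable (Function.uncurry fun w x : ℝ => (Iio w).indicator g x)
      (μ.prod (volume.restrict (Ioi 0))) := by
  have hB0 : 0 ≤ B := (norm_nonneg _).trans (hB 0)
  have hm : Measurable (Function.uncurry fun w x : ℝ => (Iio w).indicator g x) := by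
    have : (Function.uncurry fun w x : ℝ => (Iio w).indicator g x) =
        {p : ℝ × ℝ | p.2 < p.1}.indicator fun p => g p.2 := by
      ext p; simp [Function.uncurry, indicator]
    rw [this]
    exact (hg.comp measurable_snd).indicator (measurableSet_lt measurable_snd measurable_fst)
  have hle : ∀ w : ℝ, Integrable (fun x : ℝ => (Iio w).indicator (fun _ => B) x)
      (volume.restrict (Ioi 0)) := fun w => by
    rw [integrable_indicator_iff measurableSet_Iio, IntegrableOn,
      Measure.restrict_restrict measurableSet_Iio, inter_comm, Ioi_inter_Iio]
    exact integrableOn_const (by simp)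
  have hnorm : ∀ w x : ℝ, ‖(Iio w).indicator g x‖ ≤ (Iio w).indicator (fun _ => B) x :=
    fun w x => by
      rw [norm_indicator_eq_indicator_norm]
      exact indicator_le_indicator (hB x)
  rw [integrable_prod_iff hm.aestronglyMeasurable]
  refine ⟨.of_forall fun w => Integrable.mono' (hle w)
    (hg.indicator measurableSet_Iio).aestronglyMeasurable (.of_forall fun x => hnorm w x), ?_⟩
  refine Integrable.mono' (h.abs.const_mul B)
    hm.norm.stronglyMeasurable.integral_prod_right.aestronglyMeasurable (.of_forall fun w => ?_)
  rw [Real.norm_of_nonneg (integral_nonneg fun x => norm_nonneg _)]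
  calc ∫ x in Ioi 0, ‖(Iio w).indicator g x‖
      ≤ ∫ x in Ioi 0, (Iio w).indicator (fun _ => B) x := by
        refine integral_mono_of_nonneg (.of_forall fun x => norm_nonneg _) (hle w)
          (.of_forall fun x => hnorm w x)
    _ = max w 0 * B := by
        rw [integral_indicator measurableSet_Iio, Measure.restrict_restrict measurableSet_Iio,
          inter_comm, Ioi_inter_Iio, setIntegral_const]
        simp [Real.volume_real_Ioo]
    _ ≤ B * |w| := by
        rw [mul_comm]
        gcongr
        exact max_le (le_abs_self w) (abs_nonneg w)

theorem integral_indicator_tail (g : ℝ → ℂ) (x : ℝ) :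
    ∫ w, (Iio w).indicator g x ∂μ = μ.real (Ioi x) * g x := by
  have : (fun w : ℝ => (Iio w).indicator g x) = (Ioi x).indicator fun _ => g x := by
    ext w; simp [indicator]
  rw [this, integral_indicator_const _ measurableSet_Ioi, Complex.real_smul]

theorem setIntegral_indicator_exp (t w : ℝ) :
    ∫ x in Ioi (0 : ℝ), (Iio w).indicator
        (fun x : ℝ => Complex.I * t * (Complex.exp (Complex.I * (t * x : ℝ)) - 1)) x =
      if 0 < w then Complex.exp (Complex.I * (t * w : ℝ)) - 1 - Complex.I * (t * w : ℝ) else 0 := by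
  rw [integral_indicator measurableSet_Iio, Measure.restrict_restrict measurableSet_Iio,
    inter_comm, Ioi_inter_Iio]
  split_ifs with hw
  · rw [← integral_Ioc_eq_integral_Ioo, ← intervalIntegral.integral_of_le hw.le]
    have hd : ∀ x : ℝ, HasDerivAt
        (fun x : ℝ => Complex.exp (Complex.I * (t * x : ℝ)) - Complex.I * (t * x : ℝ))
        (Complex.I * t * (Complex.exp (Complex.I * (t * x : ℝ)) - 1)) x := fun x => by
      have h1 : HasDerivAt (fun x : ℝ => Complex.I * ((t * x : ℝ) : ℂ)) (Complex.I * t) x := by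
        have := (((hasDerivAt_id x).const_mul t).ofReal_comp).const_mul Complex.I
        simpa using this
      exact (h1.cexp.sub h1).congr_deriv (by ring)
    rw [intervalIntegral.integral_eq_sub_of_hasDerivAt (fun x _ => hd x)
      (Continuous.intervalIntegrable (by fun_prop) _ _)]
    simp
    ring
  · rw [Ioo_eq_empty hw]; simp

/-- As the mean is zero, `charFun μ t - 1` is the expectation of `exp (itw) - 1 - itw`. For `w > 0`
this is the integral over `(0, w)` of its derivative `it (exp (itx) - 1)`, and Fubini turns the
expectation into an integral against the tail. Negative values are handled by the reflected law with
`-t`. -/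
theorem charFun_sub_one_eq_integral_tail [IsProbabilityMeasure μ] (h : Integrable (fun w : ℝ => w) μ)
    (h0 : ∫ w, w ∂μ = 0) (t : ℝ) :
    IntegrableOn (fun x : ℝ => (μ.real (Ioi x) : ℂ) *
      (Complex.I * t * (Complex.exp (Complex.I * (t * x : ℝ)) - 1)) +
      ((μ.map fun w => -w).real (Ioi x) : ℂ) *
      (Complex.I * (-t : ℝ) * (Complex.exp (Complex.I * (-t * x : ℝ)) - 1))) (Ioi 0) ∧
    charFun μ t - 1 = ∫ x in Ioi (0 : ℝ), ((μ.real (Ioi x) : ℂ) *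
      (Complex.I * t * (Complex.exp (Complex.I * (t * x : ℝ)) - 1)) +
      ((μ.map fun w => -w).real (Ioi x) : ℂ) *
      (Complex.I * (-t : ℝ) * (Complex.exp (Complex.I * (-t * x : ℝ)) - 1))) := by
  let g : ℝ → ℝ → ℂ := fun s x => Complex.I * s * (Complex.exp (Complex.I * (s * x : ℝ)) - 1)
  have hg : ∀ s, Measurable (g s) := fun s => by fun_prop
  have hB : ∀ s x, ‖g s x‖ ≤ |s| * 2 := fun s x => by
    simp only [g]
    rw [norm_mul, norm_mul, Complex.norm_I, one_mul, Complex.norm_real, Real.norm_eq_abs]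
    gcongr
    refine (norm_sub_le _ _).trans ?_
    rw [mul_comm, Complex.norm_exp_ofReal_mul_I]
    norm_num
  have : IsProbabilityMeasure (μ.map fun w => -w) :=
    Measure.isProbabilityMeasure_map (by fun_prop)
  have hneg : Integrable (fun w : ℝ => w) (μ.map fun w => -w) := by
    rw [integrable_map_measure (by fun_prop) (by fun_prop)]
    exact h.neg
  have main : ∀ (ρ : Measure ℝ) [IsProbabilityMeasure ρ] (_ : Integrable (fun w : ℝ => w) ρ) (s : ℝ),
      Integrable (fun w : ℝ => if 0 < w then
        Complex.exp (Complex.I * (s * w : ℝ)) - 1 - Complex.I * (s * w : ℝ) else 0) ρ ∧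
      IntegrableOn (fun x : ℝ => (ρ.real (Ioi x) : ℂ) * g s x) (Ioi 0) ∧
      ∫ w : ℝ, (if 0 < w then
        Complex.exp (Complex.I * (s * w : ℝ)) - 1 - Complex.I * (s * w : ℝ) else 0) ∂ρ =
      ∫ x in Ioi (0 : ℝ), (ρ.real (Ioi x) : ℂ) * g s x := fun ρ _ hρ s => by
    have hi := integrable_prod_indicator_tail hρ (hg s) (hB s)
    have h1 := hi.integral_prod_left
    have h2 := hi.integral_prod_right
    have h3 := integral_integral_swap hi
    simp only [Function.uncurry, g, setIntegral_indicator_exp, integral_indicator_tail] at h1 h2 h3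
    exact ⟨h1, h2, h3⟩
  obtain ⟨a1, a2, a3⟩ := main μ h t
  obtain ⟨b1, b2, b3⟩ := main _ hneg (-t)
  refine ⟨a2.add b2, ?_⟩
  rw [integral_add a2 b2, ← a3, ← b3]
  rw [integrable_map_measure b1.aestronglyMeasurable (by fun_prop)] at b1
  rw [integral_map (by fun_prop) (Measurable.aestronglyMeasurable (by
    refine Measurable.ite measurableSet_Ioi (by fun_prop) (by fun_prop)))]
  simp only [Function.comp_def] at b1
  rw [← integral_add a1 b1]
  have e : ∀ w : ℝ, ((if 0 < w then
        Complex.exp (Complex.I * (t * w : ℝ)) - 1 - Complex.I * (t * w : ℝ) else 0) +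
      if 0 < -w then
        Complex.exp (Complex.I * (-t * -w : ℝ)) - 1 - Complex.I * (-t * -w : ℝ) else 0) =
      Complex.exp (t * w * Complex.I) - 1 - Complex.I * t * (w : ℂ) := fun w => by
    rcases lt_trichotomy w 0 with hw | rfl | hw
    · rw [if_neg hw.le.not_gt, if_pos (by linarith)]
      push_cast
      ring_nf
    · simp
    · rw [if_pos hw, if_neg (by linarith)]
      push_cast
      ring_nf
  have hexp : Integrable (fun w : ℝ => Complex.exp (t * w * Complex.I)) μ := by
    refine Integrable.of_bound (C := 1) (by fun_prop) (.of_forall fun x => ?_)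
    rw [← Complex.ofReal_mul, Complex.norm_exp_ofReal_mul_I]
  simp only [e]
  have h0' : ∫ w, Complex.I * t * (w : ℂ) ∂μ = 0 := by
    rw [integral_const_mul, show ∫ w : ℝ, (w : ℂ) ∂μ = ((∫ w, w ∂μ : ℝ) : ℂ) from
      integral_ofReal (𝕜 := ℂ), h0]
    simp
  have h1 : Integrable (fun w : ℝ => Complex.exp (t * w * Complex.I) - 1) μ :=
    hexp.sub (integrable_const _)
  have h2 : Integrable (fun w : ℝ => Complex.I * t * (w : ℂ)) μ := h.ofReal.const_mul _
  rw [integral_sub h1 h2, integral_sub hexp (integrable_const _), h0', charFun_apply_real]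
  simp

end TailFormula

/-! ### Second-order expansion of the characteristic function at the origin. -/

theorem exists_abs_mul_le_of_tendsto {b : ℝ → ℝ} {M l : ℝ} (hM : ∀ x, 0 < x → |b x| ≤ M)
    (hl : Tendsto (fun x => x * b x) atTop (𝓝 l)) :
    ∃ B, ∀ x, 0 < x → |b x| * x ≤ B * min 1 x := by
  have h1 : ∀ᶠ x in atTop, |x * b x| < |l| + 1 :=
    hl.abs.eventually_lt_const (by linarith)
  obtain ⟨A, hA⟩ := eventually_atTop.1 h1
  have hM0 : 0 ≤ M := (abs_nonneg _).trans (hM 1 one_pos)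
  -- The terms cover `x ≤ 1` (`M`), `1 ≤ x ≤ A` (`M * |A|`), and `x ≥ A` with `x ≥ 1` (`|l| + 1`).
  refine ⟨M + M * |A| + |l| + 1, fun x hx => ?_⟩
  have hb := hM x hx
  have p1 := mul_nonneg hM0 (abs_nonneg A)
  have p2 := abs_nonneg l
  rcases le_total 1 x with h | h
  · rw [min_eq_left h, mul_one]
    rcases le_total A x with h2 | h2
    · have := hA x h2
      rw [abs_mul, abs_of_pos hx] at this
      nlinarith
    · have : |b x| * x ≤ M * |A| := by
        gcongr
        exact h2.trans (le_abs_self A)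
      linarith
  · rw [min_eq_right h]
    gcongr
    linarith

/-- The integrand is `O(x ^ (1 - α))` at zero, where `α < 2` is needed, and `O(x ^ (-α))` at
infinity, where `α > 1` is needed. -/
theorem integrableOn_abs_mul_rpow {α : ℝ} (hα : α ∈ Ioo (1 : ℝ) 2) {b : ℝ → ℝ}
    (hc : ContinuousOn b (Ioi 0)) {M l : ℝ} (hM : ∀ x, 0 < x → |b x| ≤ M)
    (hl : Tendsto (fun x => x * b x) atTop (𝓝 l)) :
    IntegrableOn (fun x => |b x| * x * x ^ (-α)) (Ioi 0) := by
  obtain ⟨B, hB⟩ := exists_abs_mul_le_of_tendsto hM hl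
  refine Integrable.mono' ((integrableOn_min_mul_rpow hα).const_mul B) ?_ ?_
  · exact ((hc.abs.mul continuousOn_id).mul (continuousOn_id.rpow_const
      fun x hx => Or.inl (ne_of_gt hx))).aestronglyMeasurable measurableSet_Ioi
  · filter_upwards [ae_restrict_mem measurableSet_Ioi] with x (hx : 0 < x)
    rw [Real.norm_of_nonneg (by positivity), ← mul_assoc]
    exact mul_le_mul_of_nonneg_right (hB x hx) (Real.rpow_nonneg hx.le _)

/-- The second order constant in the expansion of the characteristic function at the origin. -/
noncomputable def remainderConst (α : ℝ) (a₁ a₂ : ℝ → ℝ) : ℝ :=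
  ∫ x in Ioi (0 : ℝ), (|a₁ x| * x * x ^ (-α) + |a₂ (-x)| * x * x ^ (-α))

theorem remainderConst_nonneg (α : ℝ) (a₁ a₂ : ℝ → ℝ) : 0 ≤ remainderConst α a₁ a₂ :=
  setIntegral_nonneg measurableSet_Ioi fun x (hx : 0 < x) => by positivity

/-- Puts `|t| ^ α` in the form of a tail integral, so that it cancels the contribution of the pure
power tails under the integral sign. -/
theorem abs_rpow_eq_integral {α : ℝ} (hα : α ∈ Ioo (1 : ℝ) 2) (t : ℝ) :
    IntegrableOn (fun x : ℝ => 2 * tailConst α * t * (Real.sin (t * x) * x ^ (-α))) (Ioi 0) ∧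
    |t| ^ α = ∫ x in Ioi (0 : ℝ), 2 * tailConst α * t * (Real.sin (t * x) * x ^ (-α)) := by
  have e : (fun x : ℝ => 2 * tailConst α * t * (Real.sin (t * x) * x ^ (-α))) =
      fun x : ℝ => 2 * tailConst α * |t| * (Real.sin (|t| * x) * x ^ (-α)) := by
    ext x
    rcases le_total 0 t with h | h
    · rw [abs_of_nonneg h]
    · rw [abs_of_nonpos h, neg_mul, Real.sin_neg]; ring
  rw [e]
  refine ⟨(integrableOn_sin_mul_rpow hα (abs_nonneg t)).const_mul _, ?_⟩
  rw [integral_const_mul]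
  rcases eq_or_ne t 0 with rfl | ht
  · simp [Real.zero_rpow (by linarith [hα.1] : α ≠ 0)]
  have h0 := abs_pos.2 ht
  rw [integral_sin_mul_rpow_scale h0, Real.rpow_sub h0, Real.rpow_one]
  have := two_mul_tailConst_mul_integral hα
  field_simp
  linear_combination -this

section Expansion

variable {α : ℝ} {a₁ a₂ : ℝ → ℝ} {μ : Measure ℝ}

theorem HasTailRemainders.measureReal_Ioi [IsProbabilityMeasure μ] (hμ : HasTailRemainders α a₁ a₂ μ) {x : ℝ}
    (hx : 0 < x) : μ.real (Ioi x) = (tailConst α + a₁ x) * x ^ (-α) := by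
  rw [← compl_Iic, measureReal_compl measurableSet_Iic, hμ.right x hx, Real.rpow_neg hx.le]
  simp
  ring

/-- The reflected tail is `μ (-∞, -x)`, whereas the hypothesis gives `μ (-∞, -x]`. They differ only
at atoms, hence the almost everywhere form. -/
theorem HasTailRemainders.measureReal_map_neg (hμ : HasTailRemainders α a₁ a₂ μ) :
    ∀ᵐ x ∂(volume.restrict (Ioi (0 : ℝ))),
      (μ.map fun w => -w).real (Ioi x) = (tailConst α + a₂ (-x)) * x ^ (-α) := by
  filter_upwards [ae_restrict_mem measurableSet_Ioi,
    meas_le_ae_eq_meas_lt μ (volume.restrict (Ioi (0 : ℝ))) fun w : ℝ => -w] with x hx h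
  rw [map_measureReal_apply (by fun_prop) measurableSet_Ioi, Measure.real]
  have e1 : (fun w : ℝ => -w) ⁻¹' Ioi x = {w | x < -w} := rfl
  have e2 : {w : ℝ | x ≤ -w} = Iic (-x) := by ext w; simp [le_neg]
  rw [e1, ← h, e2, ← Measure.real, hμ.left (-x) (by simpa using hx), neg_neg,
    Real.rpow_neg (le_of_lt hx)]
  rfl

/-- The terms in `c` combine to `-2 * c * t * sin (t * x) * x ^ (-α)`, which integrates to `-|t| ^
α`. In what remains, `|exp (isx) - 1| ≤ |s| * x` extracts the factor `t ^ 2`. -/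
theorem norm_charFun_sub_le [IsProbabilityMeasure μ] (hα : α ∈ Ioo (1 : ℝ) 2) (ha : TailAssumptions a₁ a₂)
    (hμ : HasTailRemainders α a₁ a₂ μ) (h : Integrable (fun w : ℝ => w) μ)
    (h0 : ∫ w, w ∂μ = 0) (t : ℝ) :
    ‖charFun μ t - (1 - |t| ^ α : ℝ)‖ ≤ remainderConst α a₁ a₂ * t ^ 2 := by
  obtain ⟨M₁, hM₁⟩ := ha.bounded_right
  obtain ⟨M₂, hM₂⟩ := ha.bounded_left
  obtain ⟨l₁, hl₁⟩ := ha.limit_right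
  obtain ⟨l₂, hl₂⟩ := ha.limit_left
  have i1 := integrableOn_abs_mul_rpow hα ha.continuousOn_right hM₁ hl₁
  have i2 : IntegrableOn (fun x => |a₂ (-x)| * x * x ^ (-α)) (Ioi 0) := by
    refine integrableOn_abs_mul_rpow (b := fun x => a₂ (-x)) (l := -l₂) hα ?_
      (fun x hx => hM₂ (-x) (by linarith)) ?_
    · exact ha.continuousOn_left.comp continuousOn_neg fun x hx => by simpa using hx
    · have := (hl₂.comp tendsto_neg_atTop_atBot).neg
      refine this.congr fun x => ?_
      simp
  obtain ⟨j1, j2⟩ := charFun_sub_one_eq_integral_tail h h0 t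
  obtain ⟨k1, k2⟩ := abs_rpow_eq_integral hα t
  have hnorm : ∀ s x : ℝ, 0 < x → ‖Complex.I * s * (Complex.exp (Complex.I * (s * x : ℝ)) - 1)‖ ≤
      s ^ 2 * x := fun s x hx => by
    rw [norm_mul, norm_mul, Complex.norm_I, one_mul, Complex.norm_real, Real.norm_eq_abs]
    have := Real.norm_exp_I_mul_ofReal_sub_one_le (x := s * x)
    rw [Real.norm_eq_abs, abs_mul, abs_of_pos hx] at this
    calc _ ≤ |s| * (|s| * x) := by gcongr
      _ = s ^ 2 * x := by rw [← mul_assoc, ← sq, sq_abs]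
  have e : charFun μ t - (1 - |t| ^ α : ℝ) = (charFun μ t - 1) + ((|t| ^ α : ℝ) : ℂ) := by
    push_cast; ring
  have k3 : ((|t| ^ α : ℝ) : ℂ) = ∫ x in Ioi (0 : ℝ),
      ((2 * tailConst α * t * (Real.sin (t * x) * x ^ (-α)) : ℝ) : ℂ) := by
    rw [k2]
    exact integral_ofReal.symm
  have k4 : IntegrableOn (fun x : ℝ =>
      ((2 * tailConst α * t * (Real.sin (t * x) * x ^ (-α)) : ℝ) : ℂ)) (Ioi 0) := k1.ofReal
  rw [e, j2, k3, ← integral_add j1 k4, remainderConst, ← integral_mul_const]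
  refine norm_integral_le_of_norm_le ((i1.add i2).mul_const _) ?_
  filter_upwards [ae_restrict_mem measurableSet_Ioi, hμ.measureReal_map_neg] with x (hx : 0 < x) hx2
  rw [hμ.measureReal_Ioi hx, hx2]
  have hs : (2 : ℂ) * Complex.I * Real.sin (t * x) =
      Complex.exp (Complex.I * (t * x : ℝ)) - Complex.exp (Complex.I * (-t * x : ℝ)) := by
    rw [mul_comm Complex.I ((t * x : ℝ) : ℂ), mul_comm Complex.I ((-t * x : ℝ) : ℂ),
      Complex.exp_ofReal_mul_I, Complex.exp_ofReal_mul_I, neg_mul, Real.cos_neg, Real.sin_neg]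
    push_cast
    ring
  have e2 : (((tailConst α + a₁ x) * x ^ (-α) : ℝ) : ℂ) *
        (Complex.I * t * (Complex.exp (Complex.I * (t * x : ℝ)) - 1)) +
      (((tailConst α + a₂ (-x)) * x ^ (-α) : ℝ) : ℂ) *
        (Complex.I * (-t : ℝ) * (Complex.exp (Complex.I * (-t * x : ℝ)) - 1)) +
      ((2 * tailConst α * t * (Real.sin (t * x) * x ^ (-α)) : ℝ) : ℂ) =
      ((a₁ x * x ^ (-α) : ℝ) : ℂ) *
        (Complex.I * t * (Complex.exp (Complex.I * (t * x : ℝ)) - 1)) +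
      ((a₂ (-x) * x ^ (-α) : ℝ) : ℂ) *
        (Complex.I * (-t : ℝ) * (Complex.exp (Complex.I * (-t * x : ℝ)) - 1)) := by
    rw [Complex.ofReal_mul (2 * tailConst α * t), Complex.ofReal_mul (Real.sin (t * x))]
    simp only [Complex.ofReal_mul, Complex.ofReal_add, Complex.ofReal_neg, Complex.ofReal_ofNat]
      at hs ⊢
    linear_combination (-(tailConst α) * (x ^ (-α) : ℝ) * Complex.I * t : ℂ) * hs +
      2 * (tailConst α) * (x ^ (-α) : ℝ) * t * (Real.sin (t * x)) * Complex.I_sq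
  refine (le_of_eq (congrArg norm e2)).trans ((norm_add_le _ _).trans ?_)
  have hx' : 0 ≤ x ^ (-α) := Real.rpow_nonneg hx.le _
  have n1 := hnorm t x hx
  have n2 := hnorm (-t) x hx
  rw [norm_mul, norm_mul (((a₂ (-x) * x ^ (-α) : ℝ) : ℂ)), Complex.norm_real, Complex.norm_real,
    Real.norm_eq_abs, Real.norm_eq_abs, abs_mul, abs_mul, abs_of_nonneg hx', add_mul]
  rw [neg_sq] at n2
  refine add_le_add ?_ ?_
  · calc _ ≤ |a₁ x| * x ^ (-α) * (t ^ 2 * x) := by gcongr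
      _ = _ := by ring
  · calc _ ≤ |a₂ (-x)| * x ^ (-α) * (t ^ 2 * x) := by gcongr
      _ = _ := by ring

end Expansion

/-! ### Comparison of `n`-th powers. -/

theorem norm_pow_sub_pow_le {z w : ℂ} {r : ℝ} (hz : ‖z‖ ≤ r) (hw : ‖w‖ ≤ r) (n : ℕ) :
    ‖z ^ n - w ^ n‖ ≤ n * r ^ (n - 1) * ‖z - w‖ := by
  have hr : 0 ≤ r := (norm_nonneg z).trans hz
  rw [← (Commute.all z w).geom_sum₂_mul, norm_mul]
  gcongr
  refine (norm_sum_le _ _).trans ?_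
  have : ∀ i ∈ Finset.range n, ‖z ^ i * w ^ (n - 1 - i)‖ ≤ r ^ (n - 1) := fun i hi => by
    rw [norm_mul, norm_pow, norm_pow]
    calc _ ≤ r ^ i * r ^ (n - 1 - i) := by gcongr
      _ = r ^ (n - 1) := by
        rw [← pow_add]
        congr 1
        have := Finset.mem_range.1 hi
        omega
  calc _ ≤ ∑ i ∈ Finset.range n, r ^ (n - 1) := Finset.sum_le_sum this
    _ = _ := by simp

theorem abs_exp_neg_sub_le {u : ℝ} (hu : 0 ≤ u) : |Real.exp (-u) - (1 - u)| ≤ u ^ 2 := by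
  rcases le_total u 1 with h | h
  · have := Real.norm_exp_sub_one_sub_id_le (x := -u) (by simpa [abs_of_nonneg hu] using h)
    rw [Real.norm_eq_abs, Real.norm_eq_abs, sq_abs, neg_sq] at this
    rwa [show Real.exp (-u) - (1 - u) = Real.exp (-u) - 1 - -u by ring]
  · have h1 : Real.exp (-u) ≤ 1 := Real.exp_le_one_iff.2 (by linarith)
    have h2 := Real.exp_pos (-u)
    rw [abs_le]
    constructor <;> nlinarith

/-- Comparison of the `n`-th power of a function that is `1 - |s| ^ α + O(s ^ 2)` with
`exp (-n * |s| ^ α)` near the origin. -/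
theorem norm_pow_sub_exp_le {α : ℝ} (hα : α ∈ Ioo (1 : ℝ) 2) {K s : ℝ} {z : ℂ}
    (hz : ‖z - (1 - |s| ^ α : ℝ)‖ ≤ K * s ^ 2) (hs1 : |s| ≤ 1)
    (hs : K * |s| ^ (2 - α) ≤ 1 / 2) {n : ℕ} (hn : 1 ≤ n) :
    ‖z ^ n - (Real.exp (-(n * |s| ^ α)) : ℝ)‖ ≤
      n * ((K + 1) * s ^ 2) * (Real.exp 1 * Real.exp (-(n * |s| ^ α / 2))) := by
  set u := |s| ^ α with hu
  have hu0 : 0 ≤ u := Real.rpow_nonneg (abs_nonneg s) α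
  have hu1 : u ≤ 1 := Real.rpow_le_one (abs_nonneg s) hs1 (by linarith [hα.1])
  have hus : u ≤ |s| := by
    calc u ≤ |s| ^ (1 : ℝ) := by
          rcases eq_or_ne s 0 with rfl | h0
          · simp [hu, Real.zero_rpow (by linarith [hα.1] : α ≠ 0)]
          exact Real.rpow_le_rpow_of_exponent_ge (abs_pos.2 h0) hs1 hα.1.le
      _ = |s| := Real.rpow_one _
  -- The error term takes away at most half of the decay, whence `‖z‖ ≤ 1 - u / 2 ≤ exp (-u / 2)`
  -- below.
  have hKs : K * s ^ 2 ≤ u / 2 := by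
    have : s ^ 2 = |s| ^ (2 - α) * u := by
      rcases eq_or_ne s 0 with rfl | h0
      · simp [hu, Real.zero_rpow (by linarith [hα.1] : α ≠ 0)]
      rw [hu, ← Real.rpow_add (abs_pos.2 h0), sub_add_cancel, Real.rpow_two, sq_abs]
    rw [this, ← mul_assoc]
    nlinarith
  have hw : ‖((Real.exp (-u) : ℝ) : ℂ)‖ ≤ Real.exp (-(u / 2)) := by
    rw [Complex.norm_real, Real.norm_of_nonneg (Real.exp_pos _).le]
    exact Real.exp_le_exp.2 (by linarith)
  have hzr : ‖z‖ ≤ Real.exp (-(u / 2)) := by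
    calc ‖z‖ = ‖(z - (1 - u : ℝ)) + ((1 - u : ℝ) : ℂ)‖ := by rw [sub_add_cancel]
      _ ≤ K * s ^ 2 + (1 - u) := by
        refine (norm_add_le _ _).trans (add_le_add hz (le_of_eq ?_))
        rw [Complex.norm_real, Real.norm_of_nonneg (by linarith)]
      _ ≤ -(u / 2) + 1 := by linarith
      _ ≤ _ := Real.add_one_le_exp _
  have hdiff : ‖z - (Real.exp (-u) : ℝ)‖ ≤ (K + 1) * s ^ 2 := by
    have h1 : ‖((Real.exp (-u) : ℝ) : ℂ) - (1 - u : ℝ)‖ ≤ s ^ 2 := by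
      rw [← Complex.ofReal_sub, Complex.norm_real, Real.norm_eq_abs]
      refine (abs_exp_neg_sub_le hu0).trans ?_
      rw [← sq_abs s]
      gcongr
    calc _ = ‖(z - (1 - u : ℝ)) - (((Real.exp (-u) : ℝ) : ℂ) - (1 - u : ℝ))‖ := by
          rw [sub_sub_sub_cancel_right]
      _ ≤ K * s ^ 2 + s ^ 2 := (norm_sub_le _ _).trans (add_le_add hz h1)
      _ = _ := by ring
  have hexp : ((Real.exp (-(n * u)) : ℝ) : ℂ) = ((Real.exp (-u) : ℝ) : ℂ) ^ n := by
    rw [← Complex.ofReal_pow, ← Real.exp_nat_mul, mul_neg]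
  rw [hexp]
  -- The telescoped difference carries the power `n - 1`. The missing factor `exp (u / 2)` is
  -- absorbed by `exp 1`, as `u ≤ 1`.
  have hn' : Real.exp (-(u / 2)) ^ (n - 1) ≤ Real.exp 1 * Real.exp (-(n * u / 2)) := by
    rw [← Real.exp_nat_mul, ← Real.exp_add, Nat.cast_sub hn]
    apply Real.exp_le_exp.2
    push_cast
    nlinarith
  calc _ ≤ n * Real.exp (-(u / 2)) ^ (n - 1) * ‖z - (Real.exp (-u) : ℝ)‖ :=
        norm_pow_sub_pow_le hzr hw n
    _ ≤ n * (Real.exp 1 * Real.exp (-(n * u / 2))) * ((K + 1) * s ^ 2) := by gcongr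
    _ = _ := by ring

/-! ### Smoothing: from ramps to distribution functions. -/

theorem measureReal_Iic_le_ramp {ν : Measure ℝ} [IsProbabilityMeasure ν]
    (h : Integrable (fun w : ℝ => w) ν) (p : ℝ) {ε : ℝ} (hε : 0 < ε) :
    ν.real (Iic p) ≤ 1 / 2 - (∫ w, |w - p| ∂ν - ∫ w, |w - (p + ε)| ∂ν) / (2 * ε) ∧
      1 / 2 - (∫ w, |w - p| ∂ν - ∫ w, |w - (p + ε)| ∂ν) / (2 * ε) ≤ ν.real (Iic (p + ε)) := by
  have hI : ∀ p, Integrable (fun w : ℝ => |w - p|) ν := fun p => (h.sub (integrable_const p)).abs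
  have hi : Integrable (fun w : ℝ => 1 / 2 - (|w - p| - |w - (p + ε)|) / (2 * ε)) ν :=
    (integrable_const _).sub (((hI p).sub (hI (p + ε))).div_const _)
  have e : ∫ w, (1 / 2 - (|w - p| - |w - (p + ε)|) / (2 * ε)) ∂ν =
      1 / 2 - (∫ w, |w - p| ∂ν - ∫ w, |w - (p + ε)| ∂ν) / (2 * ε) := by
    have hi' : Integrable (fun w : ℝ => (|w - p| - |w - (p + ε)|) / (2 * ε)) ν :=
      ((hI p).sub (hI (p + ε))).div_const _
    rw [integral_sub (integrable_const _) hi', integral_div _ (fun w : ℝ => |w - p| - |w - (p + ε)|),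
      integral_sub (hI p) (hI (p + ε))]
    simp
  have h1 : ∀ w, |w - p| - |w - (p + ε)| ≤ ε := fun w => by
    have := abs_sub_abs_le_abs_sub (w - p) (w - (p + ε))
    rw [show w - p - (w - (p + ε)) = ε by ring, abs_of_pos hε] at this
    exact this
  have h2 : ∀ w, -ε ≤ |w - p| - |w - (p + ε)| := fun w => by
    have := abs_sub_abs_le_abs_sub (w - (p + ε)) (w - p)
    rw [show w - (p + ε) - (w - p) = -ε by ring, abs_neg, abs_of_pos hε] at this
    linarith
  -- The integrand is the ramp equal to `1` up to `p`, to `0` from `p + ε` on, and linear between,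
  -- so it lies between the two indicators.
  rw [← e]
  constructor
  · rw [← integral_indicator_one measurableSet_Iic]
    refine integral_mono ((integrable_const 1).indicator measurableSet_Iic) hi fun w => ?_
    by_cases hw : w ≤ p
    · rw [indicator_of_mem (show w ∈ Iic p from hw), Pi.one_apply]
      simp only
      rw [abs_of_nonpos (by linarith), abs_of_nonpos (by linarith)]
      apply le_of_eq
      field_simp
      ring
    · rw [indicator_of_notMem (show w ∉ Iic p from hw)]
      simp only
      have : (|w - p| - |w - (p + ε)|) / (2 * ε) ≤ 1 / 2 := by
        rw [div_le_iff₀ (by positivity)]; linarith [h1 w]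
      linarith
  · rw [← integral_indicator_one (μ := ν) (measurableSet_Iic (a := p + ε))]
    refine integral_mono hi ((integrable_const 1).indicator measurableSet_Iic) fun w => ?_
    by_cases hw : w ≤ p + ε
    · rw [indicator_of_mem (show w ∈ Iic (p + ε) from hw), Pi.one_apply]
      simp only
      have : -(1 / 2) ≤ (|w - p| - |w - (p + ε)|) / (2 * ε) := by
        rw [le_div_iff₀ (by positivity)]; linarith [h2 w]
      linarith
    · rw [indicator_of_notMem (show w ∉ Iic (p + ε) from hw)]
      simp only
      rw [abs_of_nonneg (by linarith), abs_of_nonneg (by linarith)]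
      apply le_of_eq
      field_simp
      ring

/-- Two laws with finite mean are close in Kolmogorov distance if they are close on ramp functions
and one of them has no concentration at small scales. -/
theorem abs_measureReal_Iic_sub_le {ν ρ : Measure ℝ} [IsProbabilityMeasure ν]
    [IsProbabilityMeasure ρ] (h : Integrable (fun w : ℝ => w) ν)
    (h' : Integrable (fun w : ℝ => w) ρ) {ε m η : ℝ} (hε : 0 < ε)
    (hm : ∀ x, ρ.real (Ioc x (x + ε)) ≤ m * ε)
    (hη : ∀ p, |(∫ w, |w - p| ∂ν - ∫ w, |w - (p + ε)| ∂ν) -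
      (∫ w, |w - p| ∂ρ - ∫ w, |w - (p + ε)| ∂ρ)| / (2 * ε) ≤ η) (x : ℝ) :
    |ν.real (Iic x) - ρ.real (Iic x)| ≤ η + m * ε := by
  have hsplit : ∀ y, ρ.real (Iic (y + ε)) = ρ.real (Iic y) + ρ.real (Ioc y (y + ε)) := fun y => by
    rw [← measureReal_union (Iic_disjoint_Ioc le_rfl) measurableSet_Ioc,
      Iic_union_Ioc_eq_Iic (by linarith)]
  have hη' : ∀ p, |(∫ w, |w - p| ∂ν - ∫ w, |w - (p + ε)| ∂ν) / (2 * ε) -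
      (∫ w, |w - p| ∂ρ - ∫ w, |w - (p + ε)| ∂ρ) / (2 * ε)| ≤ η := fun p => by
    rw [← sub_div, abs_div, abs_of_pos (show 0 < 2 * ε by positivity)]
    exact hη p
  -- The ramp starting at `x` bounds `ν.real (Iic x)` from above and the ramp ending at `x` bounds
  -- it from below. Each comparison with `ρ` costs `η` plus the mass of one interval of length `ε`.
  have a1 := (measureReal_Iic_le_ramp h x hε).1
  have a2 := (measureReal_Iic_le_ramp h' x hε).2
  have a3 := (abs_le.1 (hη' x)).1
  have b1 := (measureReal_Iic_le_ramp h (x - ε) hε).2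
  have b2 := (measureReal_Iic_le_ramp h' (x - ε) hε).1
  have b3 := (abs_le.1 (hη' (x - ε))).2
  have c1 := hsplit x
  have c2 := hsplit (x - ε)
  have d1 := hm x
  have d2 := hm (x - ε)
  rw [sub_add_cancel] at b1 b2 b3 c2 d2
  rw [abs_le]
  constructor <;> linarith

/-- Supplies a majorant for the high frequencies: `4 / t ^ 2 ≤ 8 / (T ^ 2 + t ^ 2)` when `|t| ≥ T`,
and the right side is integrable on the whole line with integral of order `1 / T`. -/
theorem integral_inv_sq_add_sq {T : ℝ} (hT : 0 < T) :
    Integrable (fun t : ℝ => (T ^ 2 + t ^ 2)⁻¹) ∧ ∫ t : ℝ, (T ^ 2 + t ^ 2)⁻¹ = Real.pi / T := by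
  have e : (fun t : ℝ => (T ^ 2 + t ^ 2)⁻¹) =
      fun t : ℝ => (T ^ 2)⁻¹ * (fun x : ℝ => (1 + x ^ 2)⁻¹) (T⁻¹ * t) := by
    ext t
    rw [← mul_inv]
    field_simp
  rw [e]
  refine ⟨(integrable_inv_one_add_sq.comp_mul_left' (inv_ne_zero hT.ne')).const_mul _, ?_⟩
  rw [integral_const_mul, Measure.integral_comp_mul_left (fun x : ℝ => (1 + x ^ 2)⁻¹), integral_univ_inv_one_add_sq, inv_inv,
    abs_of_pos hT, smul_eq_mul]
  field_simp

/-- The ramp expectations of two laws whose characteristic functions differ by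
`O(t ^ 2 * exp (-|t| ^ α / 2))` for `|t| ≤ T`. -/
theorem abs_integral_ramp_sub_le_of_charFun {ν ρ : Measure ℝ} [IsProbabilityMeasure ν]
    [IsProbabilityMeasure ρ] (h : Integrable (fun w : ℝ => w) ν)
    (h' : Integrable (fun w : ℝ => w) ρ) {α D T ε : ℝ} (hα : 0 < α) (hD : 0 ≤ D) (hT : 0 < T)
    (hε : 0 < ε)
    (hφ : ∀ t, |t| ≤ T → ‖charFun ρ t - charFun ν t‖ ≤
      D * t ^ 2 * Real.exp (-(1 / 2) * |t| ^ α)) (p : ℝ) :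
    |(∫ w, |w - p| ∂ν - ∫ w, |w - (p + ε)| ∂ν) -
      (∫ w, |w - p| ∂ρ - ∫ w, |w - (p + ε)| ∂ρ)| / (2 * ε) ≤
      (D * (∫ t : ℝ, |t| ^ (1 : ℝ) * Real.exp (-(1 / 2) * |t| ^ α)) +
        8 * Real.pi / (ε * T)) / (2 * cosConst) := by
  have i1 := (integrable_abs_rpow_mul_exp (α := α) (s := 1) (b := 1 / 2) hα (by norm_num)
    (by norm_num)).const_mul (ε * D)
  obtain ⟨i2, e2⟩ := integral_inv_sq_add_sq hT
  have key := abs_integral_ramp_sub_le (p := p) (q := p + ε) h h' (i1.add (i2.const_mul 8))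
    fun t ht => by
      have ht2 : 0 < t ^ 2 := by positivity
      have ha : |p - (p + ε)| = ε := by
        rw [sub_add_cancel_left, abs_neg, abs_of_pos hε]
      rw [ha]
      simp only [Pi.add_apply, Real.rpow_one]
      rcases le_or_gt |t| T with hle | hgt
      · have : min 2 (|t| * ε) * ‖charFun ρ t - charFun ν t‖ / t ^ 2 ≤
            (|t| * ε) * (D * t ^ 2 * Real.exp (-(1 / 2) * |t| ^ α)) / t ^ 2 := by
          gcongr
          · exact min_le_right _ _
          · exact hφ t hle
        refine this.trans ?_
        have e : (|t| * ε) * (D * t ^ 2 * Real.exp (-(1 / 2) * |t| ^ α)) / t ^ 2 =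
            ε * D * (|t| * Real.exp (-(1 / 2) * |t| ^ α)) := by
          field_simp
        rw [e]
        have : 0 ≤ 8 * (T ^ 2 + t ^ 2)⁻¹ := by positivity
        linarith
      · have hn : ‖charFun ρ t - charFun ν t‖ ≤ 2 := by
          refine (norm_sub_le _ _).trans ?_
          have := norm_charFun_le_one (μ := ρ) (t := t)
          have := norm_charFun_le_one (μ := ν) (t := t)
          linarith
        have h4 : min 2 (|t| * ε) * ‖charFun ρ t - charFun ν t‖ / t ^ 2 ≤ 2 * 2 / t ^ 2 := by
          gcongr
          exact min_le_left _ _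
        have hTt : T ^ 2 ≤ t ^ 2 := by
          rw [← sq_abs t]
          gcongr
        have h5 : 2 * 2 / t ^ 2 ≤ 8 * (T ^ 2 + t ^ 2)⁻¹ := by
          rw [← div_eq_mul_inv, div_le_div_iff₀ ht2 (by positivity)]
          linarith
        have : 0 ≤ ε * D * (|t| * Real.exp (-(1 / 2) * |t| ^ α)) := by positivity
        linarith
  rw [integral_add' i1 (i2.const_mul 8), integral_const_mul, integral_const_mul, e2] at key
  have hc := cosConst_pos
  rw [div_le_div_iff₀ (by positivity) (by positivity)]
  have e3 : (D * (∫ t : ℝ, |t| ^ (1 : ℝ) * Real.exp (-(1 / 2) * |t| ^ α)) +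
        8 * Real.pi / (ε * T)) * (2 * ε) =
      2 * (ε * D * (∫ t : ℝ, |t| ^ (1 : ℝ) * Real.exp (-(1 / 2) * |t| ^ α)) +
        8 * (Real.pi / T)) := by
    field_simp
  rw [e3]
  linarith

/-! ### The normalized sum and the choice of scales. -/

section NormalizedSum

variable {Ω : Type*} [MeasurableSpace Ω] {P : Measure Ω} {n : ℕ}
  {X : Fin n → Ω → ℝ} {μ : Measure ℝ}

theorem charFun_map_normalizedSum (hX : ∀ i, HasLaw (X i) μ P) (hi : iIndepFun X P) (r t : ℝ) :
    charFun (P.map fun ω => r * ∑ i, X i ω) t = charFun μ (r * t) ^ n := by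
  have hm : ∀ i, AEMeasurable (X i) P := fun i => (hX i).aemeasurable
  rw [charFun_map_mul_comp (Finset.aemeasurable_fun_sum _ fun i _ => hm i),
    iIndepFun.charFun_map_fun_sum_eq_prod hm hi]
  simp [(hX _).map_eq]

theorem integrable_id_map_normalizedSum (hX : ∀ i, HasLaw (X i) μ P)
    (h : Integrable (fun w : ℝ => w) μ) (r : ℝ) :
    Integrable (fun w : ℝ => w) (P.map fun ω => r * ∑ i, X i ω) := by
  have hm : ∀ i, AEMeasurable (X i) P := fun i => (hX i).aemeasurable
  have hint : ∀ i, Integrable (X i) P := fun i => by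
    rw [← (hX i).map_eq] at h
    exact (integrable_map_measure (by fun_prop) (hm i)).1 h
  rw [integrable_map_measure (by fun_prop)
    ((Finset.aemeasurable_fun_sum _ fun i _ => hm i).const_mul r)]
  exact (integrable_finsetSum _ fun i _ => hint i).const_mul r

end NormalizedSum

/-- Used with `γ = 2 - α` to fix the radius on which the quadratic error is at most half of `|s| ^
α`. -/
theorem exists_pos_mul_rpow_le {K γ : ℝ} (hK : 0 ≤ K) (hγ : 0 < γ) :
    ∃ δ : ℝ, 0 < δ ∧ δ ≤ 1 ∧ ∀ s : ℝ, 0 ≤ s → s ≤ δ → K * s ^ γ ≤ 1 / 2 := by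
  have hb : 0 < 1 / (2 * (K + 1)) := by positivity
  refine ⟨(1 / (2 * (K + 1))) ^ (1 / γ), by positivity, ?_, fun s hs0 hs => ?_⟩
  · apply Real.rpow_le_one hb.le _ (by positivity)
    rw [div_le_one (by positivity)]
    linarith
  · have : s ^ γ ≤ 1 / (2 * (K + 1)) := by
      calc s ^ γ ≤ ((1 / (2 * (K + 1))) ^ (1 / γ)) ^ γ := by gcongr
        _ = _ := by rw [← Real.rpow_mul hb.le, one_div_mul_cancel hγ.ne', Real.rpow_one]
    calc K * s ^ γ ≤ K * (1 / (2 * (K + 1))) := by gcongr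
      _ ≤ 1 / 2 := by
        rw [mul_one_div, div_le_div_iff₀ (by positivity) two_pos]
        linarith

end StableLaw

theorem theoremB6 (α : ℝ) (hα : α ∈ Set.Ioo (1 : ℝ) 2) (a₁ a₂ : ℝ → ℝ)
    (ha : StableLaw.TailAssumptions a₁ a₂) :
    ∃ C : ℝ, 0 < C ∧
      ∀ (μ : Measure ℝ) [IsProbabilityMeasure μ],
        StableLaw.HasTailRemainders α a₁ a₂ μ →
        Integrable (fun x : ℝ => x) μ → ∫ x, x ∂μ = 0 →
        ∀ (Ω : Type*) [MeasurableSpace Ω] (P : Measure Ω) [IsProbabilityMeasure P]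
          (n : ℕ) (_ : 1 ≤ n) (X : Fin n → Ω → ℝ),
          (∀ i, HasLaw (X i) μ P) → iIndepFun X P →
          ∀ x : ℝ,
            |P.real {ω | (1 / (n : ℝ) ^ (1 / α)) * ∑ i, X i ω ≤ x} -
                (StableLaw.symmStable α hα : Measure ℝ).real (Set.Iic x)| ≤
              C / (n : ℝ) ^ ((1 / 2 : ℝ) * (1 - α / 2)) := by
  open StableLaw in
  set K := remainderConst α a₁ a₂ with hKdef
  have hK : 0 ≤ K := remainderConst_nonneg α a₁ a₂
  have hα1 := hα.1
  have hα2 := hα.2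
  have hα0 : 0 < α := by linarith
  obtain ⟨δ, hδ0, hδ1, hδ⟩ := exists_pos_mul_rpow_le hK (show 0 < 2 - α by linarith)
  obtain ⟨m, hm0, hm⟩ := exists_symmStable_Ioc_le hα
  have hc := cosConst_pos
  set J := ∫ t : ℝ, |t| ^ (1 : ℝ) * Real.exp (-(1 / 2) * |t| ^ α) with hJ
  have hJ0 : 0 ≤ J := integral_nonneg fun t => by positivity
  set A := (K + 1) * Real.exp 1 with hA
  have hA0 : 0 ≤ A := by positivity
  -- The summands come from the low frequencies, the high frequencies and the concentration of the
  -- stable law. All depend only on `α`, `a₁`, `a₂`, the law entering through `K` alone.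
  refine ⟨(A * J + 8 * Real.pi / δ) / (2 * cosConst) + m, by positivity, ?_⟩
  intro μ _ hμ hμi hμ0 Ω _ P _ n hn X hX hXi x
  have hn0 : (0 : ℝ) < n := by exact_mod_cast hn
  have hn1 : (1 : ℝ) ≤ n := by exact_mod_cast hn
  set β := (1 / 2 : ℝ) * (1 - α / 2) with hβ
  set N := (n : ℝ) ^ (1 / α) with hN
  have hN0 : 0 < N := Real.rpow_pos_of_pos hn0 _
  set ν := P.map fun ω => 1 / N * ∑ i, X i ω with hν
  have hmeas : AEMeasurable (fun ω => 1 / N * ∑ i, X i ω) P :=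
    (Finset.aemeasurable_fun_sum _ fun i _ => (hX i).aemeasurable).const_mul _
  have : IsProbabilityMeasure ν := Measure.isProbabilityMeasure_map hmeas
  have hset : P.real {ω | 1 / N * ∑ i, X i ω ≤ x} = ν.real (Set.Iic x) := by
    rw [hν, map_measureReal_apply_of_aemeasurable hmeas measurableSet_Iic]
    rfl
  rw [hset]
  -- The ramp width is the target rate itself, so the concentration error `m * ε` already has the
  -- required form.
  set ε := (n : ℝ) ^ (-β) with hε
  have hε0 : 0 < ε := Real.rpow_pos_of_pos hn0 _
  have hνi : Integrable (fun w : ℝ => w) ν := integrable_id_map_normalizedSum hX hμi _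
  set D := A * ((n : ℝ) / N ^ 2) with hD
  have hφ : ∀ t, |t| ≤ δ * N → ‖charFun (symmStable α hα : Measure ℝ) t - charFun ν t‖ ≤
      D * t ^ 2 * Real.exp (-(1 / 2) * |t| ^ α) := fun t ht => by
    have hs : |1 / N * t| ≤ δ := by
      rw [abs_mul, abs_of_pos (by positivity), one_div_mul_eq_div, div_le_iff₀ hN0]
      exact ht
    have hsα : (n : ℝ) * |1 / N * t| ^ α = |t| ^ α := by
      rw [abs_mul, abs_of_pos (by positivity), Real.mul_rpow (by positivity) (abs_nonneg t),
        Real.div_rpow zero_le_one hN0.le, hN, ← Real.rpow_mul hn0.le, one_div_mul_cancel hα0.ne',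
        Real.one_rpow, Real.rpow_one]
      field_simp
    have h1 := norm_pow_sub_exp_le hα (norm_charFun_sub_le hα ha hμ hμi hμ0
      (1 / N * t)) (hs.trans hδ1) (hδ _ (abs_nonneg _) hs) hn
    rw [hsα] at h1
    rw [norm_sub_rev, hν, charFun_map_normalizedSum hX hXi, charFun_symmStable]
    refine h1.trans (le_of_eq ?_)
    rw [show -(|t| ^ α / 2) = -(1 / 2) * |t| ^ α by ring, ← hKdef, hD, hA]
    field_simp
  have hramp := abs_integral_ramp_sub_le_of_charFun hνi (integrable_id_symmStable hα) hα0
    (show 0 ≤ D by positivity) (show 0 < δ * N by positivity) hε0 hφ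
  refine (abs_measureReal_Iic_sub_le hνi (integrable_id_symmStable hα) hε0
    (fun y => hm y ε hε0) hramp x).trans ?_
  have hε' : ((n : ℝ) ^ β)⁻¹ = ε := by rw [hε, Real.rpow_neg hn0.le]
  rw [div_eq_mul_inv _ ((n : ℝ) ^ β), hε', add_mul]
  refine add_le_add ?_ le_rfl
  rw [div_mul_eq_mul_div, add_mul]
  have hD' : D ≤ A * ε := by
    rw [hD]
    gcongr
    rw [hN, ← Real.rpow_natCast, ← Real.rpow_mul hn0.le]
    nth_rewrite 1 [← Real.rpow_one (n : ℝ)]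
    rw [← Real.rpow_sub hn0, hε]
    apply Real.rpow_le_rpow_of_exponent_le hn1
    rw [hβ, ← sub_nonneg]
    -- `D` is of order `n ^ (1 - 2/α)`, and `2/α - 1 ≥ β` because `α < 2`.
    have : -(1 / 2 * (1 - α / 2)) - (1 - 1 / α * (2 : ℕ)) = (2 - α) * (4 - α) / (4 * α) := by
      push_cast
      field_simp
      ring
    rw [this]
    exact div_nonneg (mul_nonneg (by linarith) (by linarith)) (by positivity)
  have hT : 1 / (ε * N) ≤ ε := by
    have : 1 / (ε * N) = (n : ℝ) ^ (β - 1 / α) := by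
      rw [hε, hN, ← Real.rpow_add hn0, one_div, ← Real.rpow_neg hn0.le]
      ring_nf
    rw [this, hε]
    apply Real.rpow_le_rpow_of_exponent_le hn1
    rw [hβ, ← sub_nonneg]
    -- The cutoff error is acceptable when `2 * β ≤ 1 / α`; completing the square shows that this
    -- always holds.
    have : -(1 / 2 * (1 - α / 2)) - (1 / 2 * (1 - α / 2) - 1 / α) =
        ((α - 1) ^ 2 + 1) / (2 * α) := by
      field_simp
      ring
    rw [this]
    positivity
  gcongr ?_ / _
  refine add_le_add ?_ ?_
  · calc D * J ≤ A * ε * J := by gcongr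
      _ = _ := by ring
  · calc 8 * Real.pi / (ε * (δ * N)) = 8 * Real.pi / δ * (1 / (ε * N)) := by field_simp
      _ ≤ _ := by gcongr
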